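/- A cyclically ordered group is a group $G$ with a ternary relation $R$ such that $R(a,b,c)$ implies that $a,b,c$ are pairwise distinct, $R(a,b,c)$ implies $R(b,c,a)$, for every $g$ the relation $R(g,\cdot,\cdot)$ is a strict linear order on $G\setminus\{g\}$, and $R(a,b,c)$ implies $R(hah',hbh',hch')$. The language is $\{\cdot,R,e,{}^{-1}\}$, and embeddings are embeddings of structures in this language. Let $\mathbb U$ be the group of complex numbers of modulus $1$, where $R(e^{i\theta_1},e^{i\theta_2},e^{i\theta_3})$ holds, for $\theta_1,\theta_2,\theta_3\in[0,2\pi)$, if and only if $\theta_1<\theta_2<\theta_3$ or $\theta_2<\theta_3<\theta_1$ or $\theta_3<\theta_1<\theta_2$, and let $T(\mathbb U)$ be its torsion subgroup with the induced cyclic order. An abelian cyclically ordered group is c-divisible if it is divisible and contains a subgroup isomorphic, as a cyclically ordered group, to $T(\mathbb U)$. Theorem (Lucas). Let $TcD$ be the theory whose axioms are those of abelian cyclically ordered groups, divisibility (for every $n\ge 1$ every element is an $n$-th power), and, for every prime $p$, the existence of an element of order $p$. The models of $TcD$ are exactly the c-divisible abelian cyclically ordered groups, and: 1. $TcD$ is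 complete and model-complete (every embedding between models of $TcD$ is elementary). 2. The class of models of $TcD$ has the amalgamation property. 3. $TcD$ admits quantifier elimination. 4. $T(\mathbb U)$ is a prime model of $TcD$: it is a model, and it embeds elementarily in every model. 5. $TcD$ is the model completion of the theory of abelian cyclically ordered groups: every model of $TcD$ is an abelian cyclically ordered group, every abelian cyclically ordered group embeds in a model of $TcD$, and for every abelian cyclically ordered group $G$ the union of $TcD$ and the atomic diagram of $G$ is a complete theory. Moreover, every abelian cyclically ordered group $G$ has a c-divisible hull: there are a c-divisible $H$ and an embedding $i:G\to H$ such that no proper c-divisible subgroup of $H$ contains $i(G)$, and for every embedding $f$ of $G$ in a c-divisible abelian cyclically ordered group $K$ there is exactly one embedding $h:H\to K$ with $h\circ i=f$. -/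

import Mathlib

open FirstOrder FirstOrder.Language

universe u

namespace CycOrd

/-! ### The language of cyclically ordered groups -/

/-- Function symbols: the identity, the inverse, and the group operation. -/
inductive CogFunc : ℕ → Type
  | one : CogFunc 0
  | inv : CogFunc 1
  | mul : CogFunc 2

/-- The only relation symbol is the ternary relation `R`. -/
inductive CogRel : ℕ → Type
  | R : CogRel 3

/-- The language `{·, R, e, ⁻¹}` of cyclically ordered groups. -/
def cog : FirstOrder.Language.{0, 0} where
  Functions := CogFunc
  Relations := CogRel

/-- The symbol `e`. -/
abbrev oneF : cog.Functions 0 := CogFunc.one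

/-- The symbol `⁻¹`. -/
abbrev invF : cog.Functions 1 := CogFunc.inv

/-- The symbol `·`. -/
abbrev mulF : cog.Functions 2 := CogFunc.mul

/-- The symbol `R`. -/
abbrev relF : cog.Relations 3 := CogRel.R

/-- The constant symbol `e`, as a term. -/
def oneT {α : Type} : cog.Term α := Constants.term oneF

/-- The term `t⁻¹`. -/
def invT {α : Type} (t : cog.Term α) : cog.Term α :=
  invF.apply₁ t

/-- The term `s · t`. -/
def mulT {α : Type} (s t : cog.Term α) : cog.Term α :=
  mulF.apply₂ s t

/-- The term `tⁿ`. -/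
def powT {α : Type} (t : cog.Term α) : ℕ → cog.Term α
  | 0 => oneT
  | n + 1 => mulT (powT t n) t

/-- The atomic formula `R(a, b, c)`. -/
def relR {n : ℕ} (a b c : cog.Term (Empty ⊕ Fin n)) : cog.BoundedFormula Empty n :=
  relF.boundedFormula ![a, b, c]

/-! ### The axioms -/

/-- The axioms of abelian cyclically ordered groups. -/
inductive AbelianCogAxiom : Type
  | mulAssoc | oneMul | invMul | mulComm
  | strict | cyclic | trans | total | compatible

/-- The axioms, as sentences; `&i` is the variable bound by the `i`-th outermost quantifier.
The axioms `strict`, `trans` and `total` say that `R` holds only between pairwise distinct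
elements and that, for every `g`, the relation `R(g, ·, ·)` is a strict linear order on the
complement of `g`. -/
def AbelianCogAxiom.toSentence : AbelianCogAxiom → cog.Sentence
  | .mulAssoc => ∀' ∀' ∀' (mulT (mulT (&0) (&1)) (&2) =' mulT (&0) (mulT (&1) (&2)))
  | .oneMul => ∀' (mulT oneT (&0) =' (&0))
  | .invMul => ∀' (mulT (invT (&0)) (&0) =' oneT)
  | .mulComm => ∀' ∀' (mulT (&0) (&1) =' mulT (&1) (&0))
  | .strict => ∀' ∀' ∀' (relR (&0) (&1) (&2) ⟹
      (∼((&0) =' (&1)) ⊓ (∼((&1) =' (&2)) ⊓ ∼((&2) =' (&0)))))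
  | .cyclic => ∀' ∀' ∀' (relR (&0) (&1) (&2) ⟹ relR (&1) (&2) (&0))
  | .trans => ∀' ∀' ∀' ∀'
      (relR (&0) (&1) (&2) ⟹ (relR (&0) (&2) (&3) ⟹ relR (&0) (&1) (&3)))
  | .total => ∀' ∀' ∀' (∼((&0) =' (&1)) ⟹ (∼((&0) =' (&2)) ⟹ (∼((&1) =' (&2)) ⟹
      (relR (&0) (&1) (&2) ⊔ relR (&0) (&2) (&1)))))
  | .compatible => ∀' ∀' ∀' ∀' ∀' (relR (&0) (&1) (&2) ⟹
      relR (mulT (mulT (&3) (&0)) (&4)) (mulT (mulT (&3) (&1)) (&4))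
        (mulT (mulT (&3) (&2)) (&4)))

/-- The theory of abelian cyclically ordered groups. -/
def abelianCog : cog.Theory := Set.range AbelianCogAxiom.toSentence

/-- Divisibility: for every `n ≥ 1`, every element has an `n`-th root. -/
def divisibility : cog.Theory :=
  {φ | ∃ n : ℕ, 1 ≤ n ∧ φ = ∀' ∃' (powT (&1) n =' (&0))}

/-- For every prime `p`, there is an element of order `p`. -/
def primeTorsion : cog.Theory :=
  {φ | ∃ p : ℕ, p.Prime ∧ φ = ∃' (∼((&0) =' oneT) ⊓ (powT (&0) p =' oneT))}

/-- The theory `TcD` of c-divisible abelian cyclically ordered groups. -/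
def TcD : cog.Theory := abelianCog ∪ divisibility ∪ primeTorsion

/-! ### The cyclically ordered group `T(𝕌)` -/

/-- The cyclic order of the unit circle: `R(exp(iθ₁), exp(iθ₂), exp(iθ₃))` for arguments in
`[0, 2π)` such that `θ₁ < θ₂ < θ₃` up to a cyclic permutation. -/
def circleR (a b c : Circle) : Prop :=
  ∃ x y z : ℝ, x ∈ Set.Ico 0 (2 * Real.pi) ∧ y ∈ Set.Ico 0 (2 * Real.pi) ∧
    z ∈ Set.Ico 0 (2 * Real.pi) ∧ Circle.exp x = a ∧ Circle.exp y = b ∧ Circle.exp z = c ∧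
    ((x < y ∧ y < z) ∨ (y < z ∧ z < x) ∨ (z < x ∧ x < y))

/-- The group `T(𝕌)` of roots of unity in `ℂ`. -/
abbrev TU : Type := CommGroup.torsion Circle

/-- `T(𝕌)` as a cyclically ordered group. -/
noncomputable instance : cog.Structure TU where
  funMap := fun {_} f => match f with
    | .one => fun _ => 1
    | .inv => fun v => (v 0)⁻¹
    | .mul => fun v => v 0 * v 1
  RelMap := fun {_} r => match r with
    | .R => fun v => circleR (v 0) (v 1) (v 2)

/-- A cyclically ordered abelian group is c-divisible if it is divisible and contains a copy of
the cyclically ordered group `T(𝕌)`. -/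
def IsCDivisible (M : Type u) [cog.Structure M] : Prop :=
  M ⊨ abelianCog ∧ M ⊨ divisibility ∧ Nonempty (TU ↪[cog] M)

/-- `H`, with the embedding `i`, is a c-divisible hull of `G`: it is c-divisible, it is minimal
among the c-divisible structures containing `G`, and every embedding of `G` in a c-divisible
abelian cyclically ordered group extends uniquely to `H`. -/
def IsCDivisibleHull {G H : Type u} [cog.Structure G] [cog.Structure H] (i : G ↪[cog] H) : Prop :=
  IsCDivisible H ∧
  (∀ S : cog.Substructure H, IsCDivisible S → Set.range i ⊆ S → S = ⊤) ∧
  ∀ (K : Type u) [cog.Structure K], IsCDivisible K → ∀ f : G ↪[cog] K,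
    ∃! h : H ↪[cog] K, h.comp i = f

/-! ### Model-theoretic notions -/

section ModelTheory

/-- A theory is model-complete if every embedding between its models is elementary. -/
def IsModelComplete {L : FirstOrder.Language.{0, 0}} (T : L.Theory) : Prop :=
  ∀ (M N : Type u) [L.Structure M] [L.Structure N], M ⊨ T → N ⊨ T → ∀ f : M ↪[L] N,
    ∀ (n : ℕ) (φ : L.Formula (Fin n)) (v : Fin n → M), φ.Realize (f ∘ v) ↔ φ.Realize v

/-- Quantifier elimination: every formula is equivalent modulo `T` to a quantifier-free formula
in the same free variables. -/
def HasQE {L : FirstOrder.Language.{0, 0}} (T : L.Theory) : Prop :=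
  ∀ (n : ℕ) (φ : L.Formula (Fin n)),
    ∃ ψ : L.Formula (Fin n), BoundedFormula.IsQF ψ ∧ (φ ⇔[T] ψ)

/-- The amalgamation property for the class of models of `T`. -/
def HasAP {L : FirstOrder.Language.{0, 0}} (T : L.Theory) : Prop :=
  Amalgamation {M : CategoryTheory.Bundled.{u} L.Structure | M ⊨ T}

/-- `P` is a prime model of `T`: a model that embeds elementarily in every model. -/
def IsPrimeModel {L : FirstOrder.Language.{0, 0}} (T : L.Theory) (P : Type) [L.Structure P] : Prop :=
  P ⊨ T ∧ ∀ (M : Type u) [L.Structure M], M ⊨ T → Nonempty (P ↪ₑ[L] M)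

/-- The (atomic) diagram of `M`: the atomic sentences and negations of atomic sentences with
parameters in `M` that are true in `M`. -/
def diagram (L : FirstOrder.Language.{0, 0}) (M : Type u) [L.Structure M] : L[[M]].Theory :=
  {φ | (BoundedFormula.IsAtomic φ ∨ ∃ ψ : L[[M]].Sentence, BoundedFormula.IsAtomic ψ ∧ φ = ∼ψ) ∧
    M ⊨ φ}

/-- `T'` is a model completion of `T`: every model of `T'` is a model of `T`, every model of `T`
embeds in a model of `T'`, and for every model `M` of `T` the theory `T' ∪ diagram(M)` is
complete. -/
def IsModelCompletion {L : FirstOrder.Language.{0, 0}} (T' T : L.Theory) : Prop :=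
  (∀ (M : Type u) [L.Structure M], M ⊨ T' → M ⊨ T) ∧
  (∀ (M : Type u) [L.Structure M], M ⊨ T →
    ∃ (N : Type u) (_ : L.Structure N), N ⊨ T' ∧ Nonempty (M ↪[L] N)) ∧
  (∀ (M : Type u) [L.Structure M], M ⊨ T →
    ((L.lhomWithConstants M).onTheory T' ∪ diagram L M).IsComplete)

end ModelTheory

end CycOrd

-- An abelian cyclically ordered group `M` is the quotient of a linearly ordered abelian group by a
-- cofinal infinite cyclic subgroup. Cutting the cyclic order at the identity gives a linear order
-- on `M`; whether an addition passes the identity defines a 2-cocycle `carry` with values in `{0,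
-- 1}`, and the corresponding extension of `M` by `ℤ`, ordered lexicographically, is the ordered
-- group `Unwound M`, with `M = Unwound M / ⟨turn⟩` (`Unwound.isUnwinding`). Embeddings lift to
-- ordered group morphisms fixing `turn`, and conversely such morphisms descend
-- (`IsUnwinding.exists_embedding`).
--
-- Under this dictionary `M` is a model of `TcD` exactly when `Unwound M` is divisible: elements of
-- prime order in `M` supply the fractions of `turn` (`Unwound.divisible`, `IsUnwinding.model_TcD`).
-- The c-divisible hull of `G` is therefore the divisible hull of `Unwound G` wound up again, and
-- its universal property is the unique extension of morphisms from an ordered group to its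
-- divisible hull (`exists_extension`). Applied to `ℤ ⊆ ℚ`, with `T(𝕌) = ℚ/ℤ`, the same extension
-- puts `T(𝕌)` in every model.
--
-- For quantifier elimination, two tuples with the same quantifier-free type generate isomorphic
-- substructures, whose hull `H` embeds in both models. It remains to pull an existential witness
-- back to `H` (`exists_realize_of_embedding`). Terms in one variable lift to affine maps `h + ky`
-- on the unwound group; since the unwound of `H` is divisible, hence dense, a witness outside it
-- can be replaced by any point of a small enough interval of the unwound of `H` around it. The
-- remaining claims follow: embeddings of models are elementary, `T(𝕌)` is prime and decides the
-- theory, amalgamation reduces to compactness, and the theory over a diagram is read off in the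
-- hull.

universe v w

namespace CycOrd

/-! ### The axioms, read in a structure -/

section Basic

variable {M : Type u} [cog.Structure M]

/-- The relation `R` of a structure. -/
def Rel (a b c : M) : Prop := Structure.RelMap relF ![a, b, c]

theorem realize_oneT {α : Type} (v : α → M) :
    (oneT : cog.Term α).realize v = Structure.funMap oneF ![] := by
  simp only [oneT, Constants.term, Term.realize]
  congr 1
  exact Subsingleton.elim _ _

theorem realize_invT {α : Type} (t : cog.Term α) (v : α → M) :
    (invT t).realize v = Structure.funMap invF ![t.realize v] :=
  Term.realize_functions_apply₁

theorem realize_mulT {α : Type} (s t : cog.Term α) (v : α → M) :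
    (mulT s t).realize v = Structure.funMap mulF ![s.realize v, t.realize v] :=
  Term.realize_functions_apply₂

theorem realize_relR {n : ℕ} (a b c : cog.Term (Empty ⊕ Fin n)) (v : Empty → M) (x : Fin n → M) :
    (relR a b c).Realize v x ↔
      Rel (a.realize (Sum.elim v x)) (b.realize (Sum.elim v x)) (c.realize (Sum.elim v x)) := by
  simp only [relR, BoundedFormula.realize_rel, Rel]
  refine iff_of_eq (congrArg _ ?_)
  funext i
  fin_cases i <;> rfl

variable (M) in
/-- The axioms of abelian cyclically ordered groups, with quantifiers over the structure. -/
structure IsAbelianCog : Prop where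
  mul_assoc : ∀ a b c : M, Structure.funMap mulF ![Structure.funMap mulF ![a, b], c] =
    Structure.funMap mulF ![a, Structure.funMap mulF ![b, c] ]
  one_mul : ∀ a : M, Structure.funMap mulF ![Structure.funMap oneF ![], a] = a
  inv_mul : ∀ a : M, Structure.funMap mulF ![Structure.funMap invF ![a], a] =
    Structure.funMap oneF ![]
  mul_comm : ∀ a b : M, Structure.funMap mulF ![a, b] = Structure.funMap mulF ![b, a]
  strict : ∀ a b c : M, Rel a b c → a ≠ b ∧ b ≠ c ∧ c ≠ a
  cyclic : ∀ a b c : M, Rel a b c → Rel b c a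
  trans : ∀ a b c d : M, Rel a b c → Rel a c d → Rel a b d
  total : ∀ a b c : M, a ≠ b → a ≠ c → b ≠ c → Rel a b c ∨ Rel a c b
  compatible : ∀ a b c h k : M, Rel a b c →
    Rel (Structure.funMap mulF ![Structure.funMap mulF ![h, a], k])
      (Structure.funMap mulF ![Structure.funMap mulF ![h, b], k])
      (Structure.funMap mulF ![Structure.funMap mulF ![h, c], k])

theorem model_abelianCog_iff : M ⊨ abelianCog ↔ IsAbelianCog M := by
  simp only [Theory.model_iff, abelianCog, Set.forall_mem_range]
  constructor
  · intro h
    have h1 := h .mulAssoc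
    have h2 := h .oneMul
    have h3 := h .invMul
    have h4 := h .mulComm
    have h5 := h .strict
    have h6 := h .cyclic
    have h7 := h .trans
    have h8 := h .total
    have h9 := h .compatible
    simp [AbelianCogAxiom.toSentence, Sentence.Realize, Formula.Realize, realize_mulT, realize_invT,
      realize_oneT, realize_relR, Fin.snoc] at h1 h2 h3 h4 h5 h6 h7 h8 h9
    exact ⟨h1, h2, h3, h4, h5, h6, h7, h8, h9⟩
  · rintro ⟨h1, h2, h3, h4, h5, h6, h7, h8, h9⟩ φ
    cases φ <;>
    simp [AbelianCogAxiom.toSentence, Sentence.Realize, Formula.Realize, realize_mulT, realize_invT,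
      realize_oneT, realize_relR, Fin.snoc] <;> assumption

end Basic

-- The left side is a combination of three comparisons that equals the indicator of the arc `[y,
-- z)`, including the case where the arc wraps around the cut.
open scoped Classical in
theorem linear_arc_indicator {α : Type*} [LinearOrder α] (y z t : α) :
    (if t < z then (1 : ℤ) else 0) - (if t < y then 1 else 0) + (if z < y then 1 else 0) =
      if (y < t ∧ t < z ∨ t < z ∧ z < y ∨ z < y ∧ y < t) ∨ (t = y ∧ t ≠ z) then 1 else 0 := by
  grind

/-! ### The cut order and the carry cocycle -/

section GroupOrder

variable {M : Type u} [cog.Structure M]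

theorem relMap_rel (v : Fin 3 → M) : Structure.RelMap relF v ↔ Rel (v 0) (v 1) (v 2) := by
  refine iff_of_eq (congrArg _ ?_)
  funext i
  fin_cases i <;> rfl

variable [hM : M ⊨ abelianCog]

/-- The group structure of an abelian cyclically ordered group, in additive notation. -/
noncomputable instance addCommGroup : AddCommGroup M :=
  have h := model_abelianCog_iff.1 hM
  letI : Add M := ⟨fun a b => Structure.funMap mulF ![a, b]⟩
  letI : Neg M := ⟨fun a => Structure.funMap invF ![a]⟩
  letI : Zero M := ⟨Structure.funMap oneF ![]⟩
  { AddGroup.ofLeftAxioms h.mul_assoc h.one_mul h.inv_mul with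
    add_comm := h.mul_comm }

theorem funMap_mul (v : Fin 2 → M) : Structure.funMap mulF v = v 0 + v 1 := by
  change _ = Structure.funMap mulF ![v 0, v 1]
  congr 1
  funext i
  fin_cases i <;> rfl

theorem funMap_inv (v : Fin 1 → M) : Structure.funMap invF v = -v 0 := by
  change _ = Structure.funMap invF ![v 0]
  congr 1
  funext i
  fin_cases i
  rfl

theorem funMap_one (v : Fin 0 → M) : Structure.funMap oneF v = (0 : M) := by
  change _ = Structure.funMap oneF ![]
  congr 1
  exact Subsingleton.elim _ _

theorem Rel.ne {a b c : M} (h : Rel a b c) : a ≠ b ∧ b ≠ c ∧ c ≠ a :=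
  (model_abelianCog_iff.1 hM).strict a b c h

theorem Rel.rotate {a b c : M} (h : Rel a b c) : Rel b c a :=
  (model_abelianCog_iff.1 hM).cyclic a b c h

theorem Rel.trans {a b c d : M} (h : Rel a b c) (h' : Rel a c d) : Rel a b d :=
  (model_abelianCog_iff.1 hM).trans a b c d h h'

theorem Rel.total {a b c : M} (h : a ≠ b) (h' : a ≠ c) (h'' : b ≠ c) : Rel a b c ∨ Rel a c b :=
  (model_abelianCog_iff.1 hM).total a b c h h' h''

theorem Rel.asymm {a b c : M} (h : Rel a b c) : ¬Rel a c b := fun h' =>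
  (h.trans h').ne.2.1 rfl

theorem Rel.add_right {a b c : M} (h : Rel a b c) (k : M) : Rel (a + k) (b + k) (c + k) := by
  have := (model_abelianCog_iff.1 hM).compatible a b c 0 k h
  change Rel (0 + a + k) (0 + b + k) (0 + c + k) at this
  simpa using this

theorem rel_add_right_iff {a b c : M} (k : M) : Rel (a + k) (b + k) (c + k) ↔ Rel a b c :=
  ⟨fun h => by simpa using h.add_right (-k), fun h => h.add_right k⟩

open scoped Classical in
/-- The linear order obtained by cutting the cyclic order at the identity. -/
noncomputable instance linearOrder : LinearOrder M where
  le a b := a = b ∨ (a = 0 ∧ b ≠ 0) ∨ Rel 0 a b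
  le_refl a := .inl rfl
  le_trans a b c h h' := by
    rcases h with rfl | ⟨rfl, h⟩ | h
    · exact h'
    · rcases h' with rfl | ⟨rfl, -⟩ | h'
      · exact .inr (.inl ⟨rfl, h⟩)
      · exact absurd rfl h
      · exact .inr (.inl ⟨rfl, h'.ne.2.2⟩)
    · rcases h' with rfl | ⟨rfl, -⟩ | h'
      · exact .inr (.inr h)
      · exact absurd rfl h.ne.2.2
      · exact .inr (.inr (h.trans h'))
  le_antisymm a b h h' := by
    rcases h with rfl | ⟨rfl, h⟩ | h
    · rfl
    · rcases h' with rfl | ⟨rfl, -⟩ | h'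
      · rfl
      · exact absurd rfl h
      · exact absurd rfl h'.ne.2.2
    · rcases h' with rfl | ⟨rfl, -⟩ | h'
      · rfl
      · exact absurd rfl h.ne.2.2
      · exact absurd h' h.asymm
  le_total a b := by
    by_cases hab : a = b
    · exact .inl (.inl hab)
    by_cases ha : a = 0
    · exact .inl (.inr (.inl ⟨ha, fun h => hab (ha.trans h.symm)⟩))
    by_cases hb : b = 0
    · exact .inr (.inr (.inl ⟨hb, ha⟩))
    rcases Rel.total (Ne.symm ha) (Ne.symm hb) hab with h | h
    · exact .inl (.inr (.inr h))
    · exact .inr (.inr (.inr h))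
  toDecidableLE := Classical.decRel _

theorem cut_le_iff {a b : M} : a ≤ b ↔ a = b ∨ (a = 0 ∧ b ≠ 0) ∨ Rel 0 a b := Iff.rfl

theorem cut_lt_iff {a b : M} : a < b ↔ (a = 0 ∧ b ≠ 0) ∨ Rel 0 a b := by
  rw [lt_iff_le_and_ne, cut_le_iff]
  constructor
  · tauto
  · rintro (⟨rfl, h⟩ | h)
    · exact ⟨.inr (.inl ⟨rfl, h⟩), h.symm⟩
    · exact ⟨.inr (.inr h), h.ne.2.1⟩

theorem cut_zero_le (a : M) : 0 ≤ a := by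
  rw [cut_le_iff]
  tauto

theorem rel_zero_iff {a b : M} : Rel 0 a b ↔ 0 < a ∧ a < b := by
  constructor
  · intro h
    exact ⟨(cut_zero_le a).lt_of_ne h.ne.1, cut_lt_iff.2 (.inr h)⟩
  · rintro ⟨h, h'⟩
    rcases cut_lt_iff.1 h' with ⟨rfl, -⟩ | h'
    · exact absurd h (lt_irrefl _)
    · exact h'

theorem rel_of_lt_of_lt {a b c : M} (h : a < b) (h' : b < c) : Rel a b c := by
  rcases (cut_zero_le a).eq_or_lt with rfl | ha
  · exact rel_zero_iff.2 ⟨h, h'⟩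
  have h1 : Rel 0 a b := rel_zero_iff.2 ⟨ha, h⟩
  have h2 : Rel 0 b c := rel_zero_iff.2 ⟨ha.trans h, h'⟩
  exact (h2.rotate.trans h1.rotate.rotate).rotate.rotate

theorem rel_iff {a b c : M} :
    Rel a b c ↔ (a < b ∧ b < c) ∨ (b < c ∧ c < a) ∨ (c < a ∧ a < b) := by
  constructor
  · intro h
    have key : ∀ {a b c : M}, a < c → c < b → ¬Rel a b c := fun h h' hr =>
      hr.asymm (rel_of_lt_of_lt h h')
    obtain ⟨h1, h2, h3⟩ := h.ne
    have k1 := fun p q => key (a := a) (b := b) (c := c) p q h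
    have k2 := fun p q => key (a := b) (b := c) (c := a) p q h.rotate
    have k3 := fun p q => key (a := c) (b := a) (c := b) p q h.rotate.rotate
    rcases lt_or_gt_of_ne h1 with h1 | h1 <;> rcases lt_or_gt_of_ne h2 with h2 | h2 <;>
      rcases lt_or_gt_of_ne h3 with h3 | h3 <;> tauto
  · rintro (⟨h, h'⟩ | ⟨h, h'⟩ | ⟨h, h'⟩)
    · exact rel_of_lt_of_lt h h'
    · exact (rel_of_lt_of_lt h h').rotate.rotate
    · exact (rel_of_lt_of_lt h h').rotate

/-- The carry of an addition: `1` if adding `b` to `a` passes the identity, else `0`. -/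
noncomputable def carry (a b : M) : ℤ := if a + b < a then 1 else 0

open scoped Classical in
/-- The indicator of `t` lying in the half-open arc from `y` to `z`, in terms of the cut order. -/
theorem arc_indicator (y z t : M) :
    (if t < z then (1 : ℤ) else 0) - (if t < y then 1 else 0) + (if z < y then 1 else 0) =
      if Rel y t z ∨ (t = y ∧ t ≠ z) then 1 else 0 := by
  rw [rel_iff]
  convert! linear_arc_indicator y z t

/-- Lying in an arc is expressed by `R` and equality, so it is translation invariant although the
cut order is not. The cocycle identity and the monotonicity of the carry are instances of this
equation. -/
theorem arc_add_right (y z t k : M) :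
    (if t + k < z + k then (1 : ℤ) else 0) - (if t + k < y + k then 1 else 0) +
      (if z + k < y + k then 1 else 0) =
    (if t < z then (1 : ℤ) else 0) - (if t < y then 1 else 0) + (if z < y then 1 else 0) := by
  classical
  rw [arc_indicator, arc_indicator]
  simp only [rel_add_right_iff, add_left_inj, ne_eq]

theorem carry_cocycle (a b d : M) :
    carry a b + carry (a + b) d = carry b d + carry a (b + d) := by
  have h := arc_add_right 0 b (b + d) a
  have h0 : ∀ x : M, ¬x < 0 := fun x => (cut_zero_le x).not_gt
  rw [zero_add, add_comm (b + d) a, add_comm b a, ← add_assoc] at h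
  simp only [h0, if_false] at h
  simp only [carry, ← add_assoc]
  linarith

theorem carry_mem (a b : M) : 0 ≤ carry a b ∧ carry a b ≤ 1 := by
  unfold carry
  split_ifs <;> simp

/-- Three cocycle identities give `2 (carry a b - carry b a) = carry (a + a) b - carry b (a + a)`.
The right side has absolute value at most `1`, so both sides vanish. -/
theorem carry_comm (a b : M) : carry a b = carry b a := by
  have h1 := carry_cocycle a a b
  have h2 := carry_cocycle b a a
  have h3 := carry_cocycle a b a
  rw [add_comm b a] at h2 h3
  have := carry_mem (a + a) b
  have := carry_mem b (a + a)
  omega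

theorem carry_zero (a : M) : carry a 0 = 0 := by simp [carry]

/-- Translation by `d` is increasing once the carry is recorded: this is what makes the
lexicographic order on the unwound compatible with addition. -/
theorem carry_strictMono {a b : M} (d : M) (h : a < b) :
    carry d a < carry d b ∨ (carry d a = carry d b ∧ d + a < d + b) := by
  have h' := arc_add_right 0 b a d
  have h0 : ∀ x : M, ¬x < 0 := fun x => (cut_zero_le x).not_gt
  rw [zero_add, add_comm a d, add_comm b d] at h'
  simp only [h0, h, if_false, if_true] at h'
  simp only [carry]
  split_ifs at h' ⊢ <;> simp_all

end GroupOrder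

/-! ### The unwound group -/

section Unwound

/-- The unwound of an abelian cyclically ordered group: the elements of the group together with
a number of turns. -/
@[ext]
structure Unwound (M : Type u) where
  /-- the number of turns -/
  turns : ℤ
  /-- the underlying element -/
  pt : M

namespace Unwound

variable {M : Type u} [cog.Structure M] [hM : M ⊨ abelianCog]

noncomputable instance : AddCommGroup (Unwound M) :=
  letI : Add (Unwound M) := ⟨fun x y => ⟨x.turns + y.turns + carry x.pt y.pt, x.pt + y.pt⟩⟩
  letI : Neg (Unwound M) := ⟨fun x => ⟨-x.turns - carry (-x.pt) x.pt, -x.pt⟩⟩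
  letI : Zero (Unwound M) := ⟨⟨0, 0⟩⟩
  { AddGroup.ofLeftAxioms (G := Unwound M)
      (fun x y z => Unwound.ext
        (by
          have := carry_cocycle x.pt y.pt z.pt
          change x.turns + y.turns + carry x.pt y.pt + z.turns + carry (x.pt + y.pt) z.pt =
            x.turns + (y.turns + z.turns + carry y.pt z.pt) + carry x.pt (y.pt + z.pt)
          linarith)
        (add_assoc _ _ _))
      (fun x => Unwound.ext
        (by
          change 0 + x.turns + carry 0 x.pt = x.turns
          rw [carry_comm, carry_zero]
          ring)
        (zero_add _))
      (fun x => Unwound.ext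
        (by
          change -x.turns - carry (-x.pt) x.pt + x.turns + carry (-x.pt) x.pt = 0
          ring)
        (neg_add_cancel _)) with
    add_comm := fun x y => Unwound.ext
      (by
        change x.turns + y.turns + carry x.pt y.pt = y.turns + x.turns + carry y.pt x.pt
        rw [carry_comm, add_comm x.turns])
      (add_comm _ _) }

theorem turns_add (x y : Unwound M) :
    (x + y).turns = x.turns + y.turns + carry x.pt y.pt := rfl

theorem pt_add (x y : Unwound M) : (x + y).pt = x.pt + y.pt := rfl

noncomputable instance : LinearOrder (Unwound M) :=
  LinearOrder.lift' (fun x => toLex (x.turns, x.pt)) fun x y h => by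
    simpa [Unwound.ext_iff] using h

theorem lt_iff {x y : Unwound M} :
    x < y ↔ x.turns < y.turns ∨ (x.turns = y.turns ∧ x.pt < y.pt) :=
  Prod.Lex.toLex_lt_toLex

instance : IsOrderedCancelAddMonoid (Unwound M) :=
  .of_add_lt_add_left fun a b c h => by
    rw [lt_iff] at h ⊢
    simp only [turns_add, pt_add]
    have h1 := carry_mem a.pt b.pt
    have h2 := carry_mem a.pt c.pt
    rcases h with h | ⟨h, h'⟩
    · rcases lt_or_ge b.pt c.pt with hlt | hge
      · rcases carry_strictMono a.pt hlt with h3 | h3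
        · left; omega
        · left; omega
      · by_cases h4 : b.turns + 1 < c.turns
        · left; omega
        -- The only way a lead of one turn can be lost: `b` carries and `c` does not. The turns then
        -- tie, and `a + b < a ≤ a + c` decides in the cut order.
        · by_cases h5 : carry a.pt b.pt = 1 ∧ carry a.pt c.pt = 0
          · right
            refine ⟨by omega, ?_⟩
            have h6 : a.pt + b.pt < a.pt := by
              by_contra hc
              simp [carry, hc] at h5
            have h7 : ¬a.pt + c.pt < a.pt := by
              intro hc
              simp [carry, hc] at h5
            exact h6.trans_le (not_lt.1 h7)
          · left; omega
    · rcases carry_strictMono a.pt h' with h3 | h3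
      · left; omega
      · right
        exact ⟨by omega, h3.2⟩

instance : IsOrderedAddMonoid (Unwound M) := inferInstance

/-- One full turn. -/
noncomputable def turn : Unwound M := ⟨1, 0⟩

/-- The projection of the unwound to the group. -/
noncomputable def proj : Unwound M →+ M := AddMonoidHom.mk' pt fun _ _ => rfl

theorem proj_apply (x : Unwound M) : proj x = x.pt := rfl

theorem zsmul_turn (n : ℤ) : n • (turn : Unwound M) = ⟨n, 0⟩ := by
  have h : ∀ n : ℤ, (n + 1) • (turn : Unwound M) = n • turn + turn := fun n => by
    rw [add_smul, one_smul]
  induction n with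
  | zero => rw [zero_smul]; rfl
  | succ n ih =>
    rw [h, ih]
    refine Unwound.ext ?_ (add_zero _)
    simp [turns_add, turn, carry_zero]
  | pred n ih =>
    have := h (-n - 1)
    rw [sub_add_cancel, ih] at this
    rw [eq_sub_of_add_eq this.symm, sub_eq_iff_eq_add]
    refine Unwound.ext ?_ (add_zero _).symm
    simp [turns_add, turn, carry_zero]

theorem add_zsmul_turn (x : Unwound M) (n : ℤ) : x + n • turn = ⟨x.turns + n, x.pt⟩ := by
  rw [zsmul_turn]
  refine Unwound.ext ?_ (add_zero _)
  simp [turns_add, carry_zero]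

theorem turn_pos : (0 : Unwound M) < turn := lt_iff.2 (.inl Int.zero_lt_one)

end Unwound

end Unwound

/-! ### Quotients of ordered groups by a cofinal element -/

section Unwinding

variable {Γ : Type v} [AddCommGroup Γ] [LinearOrder Γ] [IsOrderedAddMonoid Γ]
  {M : Type u} [cog.Structure M]

/-- The structure `M` is the quotient, by `π`, of the ordered group `Γ` by the subgroup generated by
the cofinal positive element `z`, with the cyclic order induced by the order of `Γ`. -/
structure IsUnwinding (z : Γ) (π : Γ → M) : Prop where
  pos : 0 < z
  bdd : ∀ x, ∃ n : ℤ, x < n • z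
  surj : Function.Surjective π
  map_eq : ∀ {x y}, π x = π y ↔ ∃ n : ℤ, x = y + n • z
  map_one : Structure.funMap oneF ![] = π 0
  map_inv : ∀ x, Structure.funMap invF ![π x] = π (-x)
  map_mul : ∀ x y, Structure.funMap mulF ![π x, π y] = π (x + y)
  rel : ∀ {x y t}, Rel (π x) (π y) (π t) ↔
    ∃ m n : ℤ, x < y + m • z ∧ y + m • z < t + n • z ∧ t + n • z < x + z

namespace IsUnwinding

variable {z : Γ} {π : Γ → M}

omit [IsOrderedAddMonoid Γ] in
theorem map_add_zsmul (h : IsUnwinding z π) (x : Γ) (n : ℤ) : π (x + n • z) = π x :=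
  h.map_eq.2 ⟨n, rfl⟩

/-- Take the least `m` with `x ≤ y + m • z`; cofinality of `z` bounds the candidates below and
supplies one. -/
theorem exists_mem_Ico (h : IsUnwinding z π) (x y : Γ) :
    ∃ m : ℤ, x ≤ y + m • z ∧ y + m • z < x + z := by
  obtain ⟨n, hn⟩ := h.bdd (y - x)
  obtain ⟨k, hk⟩ := h.bdd (x - y)
  obtain ⟨m, hm, hmin⟩ := Int.exists_least_of_bdd (P := fun m : ℤ => x ≤ y + m • z)
    ⟨-n, fun m hm => by
      have : -n • z < m • z := by
        rw [neg_smul, neg_lt_iff_pos_add]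
        have := add_lt_add_of_lt_of_le hn hm
        have e : y - x + x = y + 0 := by abel
        rw [e, add_left_comm, add_lt_add_iff_left] at this
        rwa [add_comm]
      exact ((zsmul_lt_zsmul_iff_left h.pos).1 this).le⟩
    ⟨k, by rw [add_comm]; exact (sub_lt_iff_lt_add.1 hk).le⟩
  refine ⟨m, hm, not_le.1 fun hc => ?_⟩
  have := hmin (m - 1) (by
    rw [sub_smul, one_smul, ← add_sub_assoc]
    exact le_sub_iff_add_le.2 hc)
  omega

theorem not_lt_of_eq (h : IsUnwinding z π) {x y : Γ} (he : π x = π y) (h1 : x < y)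
    (h2 : y < x + z) : False := by
  obtain ⟨n, rfl⟩ := h.map_eq.1 he.symm
  have h3 : (0 : ℤ) • z < n • z := by simpa using h1
  have h4 : n • z < (1 : ℤ) • z := by simpa using h2
  have := (zsmul_lt_zsmul_iff_left h.pos).1 h3
  have := (zsmul_lt_zsmul_iff_left h.pos).1 h4
  omega

theorem eq_of_mem_Ioo (h : IsUnwinding z π) {x y t : Γ} (he : π y = π t) (hy : x < y)
    (hy' : y < x + z) (ht : x < t) (ht' : t < x + z) : y = t := by
  rcases lt_trichotomy y t with hl | hl | hl
  · exact (h.not_lt_of_eq he hl (ht'.trans (by simpa using hy))).elim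
  · exact hl
  · exact (h.not_lt_of_eq he.symm hl (hy'.trans (by simpa using ht))).elim

/-- Normalizing representatives into one period starting at `x` turns `R(x, ·, ·)` into the linear
order of `Γ` on that period. -/
theorem isAbelianCog (h : IsUnwinding z π) : IsAbelianCog M where
  mul_assoc a b c := by
    obtain ⟨x, rfl⟩ := h.surj a
    obtain ⟨y, rfl⟩ := h.surj b
    obtain ⟨t, rfl⟩ := h.surj c
    simp only [h.map_mul, add_assoc]
  one_mul a := by
    obtain ⟨x, rfl⟩ := h.surj a
    simp only [h.map_one, h.map_mul, zero_add]
  inv_mul a := by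
    obtain ⟨x, rfl⟩ := h.surj a
    simp only [h.map_one, h.map_inv, h.map_mul, neg_add_cancel]
  mul_comm a b := by
    obtain ⟨x, rfl⟩ := h.surj a
    obtain ⟨y, rfl⟩ := h.surj b
    simp only [h.map_mul, add_comm]
  strict a b c := by
    obtain ⟨x, rfl⟩ := h.surj a
    obtain ⟨y, rfl⟩ := h.surj b
    obtain ⟨t, rfl⟩ := h.surj c
    rw [h.rel]
    rintro ⟨m, n, h1, h2, h3⟩
    refine ⟨fun he => ?_, fun he => ?_, fun he => ?_⟩
    · rw [← h.map_add_zsmul y m] at he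
      exact h.not_lt_of_eq he h1 (h2.trans h3)
    · rw [← h.map_add_zsmul y m, ← h.map_add_zsmul t n] at he
      exact h.not_lt_of_eq he h2 (h3.trans (by simpa using h1))
    · rw [← h.map_add_zsmul t n] at he
      exact h.not_lt_of_eq he.symm (h1.trans h2) h3
  cyclic a b c := by
    obtain ⟨x, rfl⟩ := h.surj a
    obtain ⟨y, rfl⟩ := h.surj b
    obtain ⟨t, rfl⟩ := h.surj c
    rw [h.rel, h.rel]
    rintro ⟨m, n, h1, h2, h3⟩
    -- Everything is shifted by `-m • z` so that the period starts at `y`; the point `x` then moves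
    -- up by one period, whence `1 - m`.
    refine ⟨n - m, 1 - m, ?_, ?_, ?_⟩
    · rw [sub_smul, ← add_sub_assoc]
      exact lt_sub_iff_add_lt.2 h2
    · rw [sub_smul, sub_smul, one_smul, ← add_sub_assoc, ← add_sub_assoc]
      exact sub_lt_sub_right h3 _
    · rw [sub_smul, one_smul, ← add_sub_assoc, sub_lt_iff_lt_add, add_right_comm]
      exact add_lt_add_left h1 z
  trans a b c d := by
    obtain ⟨x, rfl⟩ := h.surj a
    obtain ⟨y, rfl⟩ := h.surj b
    obtain ⟨t, rfl⟩ := h.surj c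
    obtain ⟨s, rfl⟩ := h.surj d
    rw [h.rel, h.rel, h.rel]
    rintro ⟨m, n, h1, h2, h3⟩ ⟨m', n', h1', h2', h3'⟩
    -- The two hypotheses use a priori different representatives of the middle element; both lie in
    -- the same open period, so they agree and the inequalities chain.
    have := h.eq_of_mem_Ioo (y := t + n • z) (t := t + m' • z) (by simp only [h.map_add_zsmul])
      (h1.trans h2) h3 h1' (h2'.trans h3')
    exact ⟨m, n', h1, (h2.trans_eq this).trans h2', h3'⟩
  total a b c := by
    obtain ⟨x, rfl⟩ := h.surj a
    obtain ⟨y, rfl⟩ := h.surj b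
    obtain ⟨t, rfl⟩ := h.surj c
    intro hxy hxt hyt
    obtain ⟨m, h1, h2⟩ := h.exists_mem_Ico x y
    obtain ⟨n, h3, h4⟩ := h.exists_mem_Ico x t
    rw [← h.map_add_zsmul y m] at hxy hyt
    rw [← h.map_add_zsmul t n] at hxt hyt
    have h1 := lt_of_le_of_ne h1 fun e => hxy (congrArg π e)
    have h3 := lt_of_le_of_ne h3 fun e => hxt (congrArg π e)
    rw [h.rel, h.rel]
    rcases lt_or_gt_of_ne (fun e => hyt (congrArg π e)) with hl | hl
    · exact .inl ⟨m, n, h1, hl, h4⟩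
    · exact .inr ⟨n, m, h3, hl, h2⟩
  compatible a b c d e := by
    obtain ⟨x, rfl⟩ := h.surj a
    obtain ⟨y, rfl⟩ := h.surj b
    obtain ⟨t, rfl⟩ := h.surj c
    obtain ⟨p, rfl⟩ := h.surj d
    obtain ⟨q, rfl⟩ := h.surj e
    simp only [h.map_mul, h.rel]
    rintro ⟨m, n, h1, h2, h3⟩
    have e : ∀ x k, p + x + q + k = (x + k) + (p + q) := fun x k => by abel
    have e' : ∀ x, p + x + q = x + (p + q) := fun x => by abel
    refine ⟨m, n, ?_, ?_, ?_⟩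
    · rw [e, e']
      exact add_lt_add_left h1 _
    · rw [e, e]
      exact add_lt_add_left h2 _
    · rw [e, e]
      exact add_lt_add_left h3 _

theorem model (h : IsUnwinding z π) : M ⊨ abelianCog :=
  model_abelianCog_iff.2 h.isAbelianCog

section Hom

variable [M ⊨ abelianCog]

omit [IsOrderedAddMonoid Γ] in
theorem map_add (h : IsUnwinding z π) (x y : Γ) : π (x + y) = π x + π y :=
  (h.map_mul x y).symm

omit [IsOrderedAddMonoid Γ] in
theorem map_nsmul (h : IsUnwinding z π) (n : ℕ) (x : Γ) : π (n • x) = n • π x :=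
  _root_.map_nsmul (AddMonoidHom.mk' π h.map_add) n x

end Hom

variable {Γ' : Type*} [AddCommGroup Γ'] [LinearOrder Γ'] [IsOrderedAddMonoid Γ']
  {M' : Type w} [cog.Structure M'] {z' : Γ'} {π' : Γ' → M'}

/-- A morphism of ordered groups that preserves the distinguished element induces an embedding of
the quotients. -/
theorem exists_embedding (h : IsUnwinding z π) (h' : IsUnwinding z' π') (φ : Γ →+ Γ')
    (hφ : StrictMono φ) (hz : φ z = z') : ∃ f : M ↪[cog] M', ∀ x, f (π x) = π' (φ x) := by
  -- Since `φ` is injective and sends `z` to `z'`, the fibres correspond exactly: one direction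
  -- makes the induced map well defined, the other makes it injective.
  have hinj : ∀ {x y}, π' (φ x) = π' (φ y) ↔ π x = π y := by
    intro x y
    rw [h.map_eq, h'.map_eq]
    refine exists_congr fun n => ?_
    rw [← hz, ← map_zsmul, ← _root_.map_add, hφ.injective.eq_iff]
  let F : M → M' := fun a => π' (φ (Function.surjInv h.surj a))
  have hF : ∀ x, F (π x) = π' (φ x) := fun x => hinj.2 (Function.surjInv_eq h.surj _)
  have hmod := h.model
  have hmod' := h'.model
  refine ⟨⟨⟨F, ?_⟩, ?_, ?_⟩, hF⟩
  · intro a b hab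
    obtain ⟨x, rfl⟩ := h.surj a
    obtain ⟨y, rfl⟩ := h.surj b
    rw [hF, hF] at hab
    exact hinj.1 hab
  · intro n f v
    change F _ = _
    match n, f with
    | _, .one =>
      have e := (funMap_one v).trans ((funMap_one ![]).symm.trans h.map_one)
      have e' := (funMap_one (F ∘ v)).trans ((funMap_one ![]).symm.trans h'.map_one)
      refine (congrArg F e).trans (Eq.trans ?_ e'.symm)
      rw [hF, map_zero]
    | _, .inv =>
      refine (congrArg F (funMap_inv v)).trans (Eq.trans ?_ (funMap_inv (F ∘ v)).symm)
      obtain ⟨x, hx⟩ := h.surj (v 0)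
      change F (-v 0) = -F (v 0)
      rw [← hx, hF]
      refine (congrArg F (h.map_inv x)).trans ((hF _).trans ?_)
      rw [_root_.map_neg]
      exact (h'.map_inv _).symm
    | _, .mul =>
      refine (congrArg F (funMap_mul v)).trans (Eq.trans ?_ (funMap_mul (F ∘ v)).symm)
      obtain ⟨x, hx⟩ := h.surj (v 0)
      obtain ⟨y, hy⟩ := h.surj (v 1)
      change F (v 0 + v 1) = F (v 0) + F (v 1)
      rw [← hx, ← hy, hF, hF, ← h.map_add, ← h'.map_add, hF, _root_.map_add]
  · intro n r v
    match n, r with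
    | _, .R =>
      refine (relMap_rel (F ∘ v)).trans (Iff.trans ?_ (relMap_rel v).symm)
      obtain ⟨x, hx⟩ := h.surj (v 0)
      obtain ⟨y, hy⟩ := h.surj (v 1)
      obtain ⟨t, ht⟩ := h.surj (v 2)
      change Rel (F (v 0)) (F (v 1)) (F (v 2)) ↔ _
      rw [← hx, ← hy, ← ht, hF, hF, hF, h.rel, h'.rel, ← hz]
      simp only [← map_zsmul, ← _root_.map_add, hφ.lt_iff_lt]

end IsUnwinding

end Unwinding

/-! ### Embeddings and their lifts to the unwound groups -/

section Embedding

variable {M : Type u} {N : Type w} [cog.Structure M] [cog.Structure N]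

theorem map_rel_iff (f : M ↪[cog] N) {a b c : M} : Rel (f a) (f b) (f c) ↔ Rel a b c := by
  exact (relMap_rel (f ∘ ![a, b, c])).symm.trans (f.map_rel relF ![a, b, c])

variable [M ⊨ abelianCog] [N ⊨ abelianCog]

/-- An embedding, as a homomorphism of additive groups. -/
noncomputable def toAddHom (f : M ↪[cog] N) : M →+ N :=
  AddMonoidHom.mk' f fun a b => by
    have := f.map_fun mulF ![a, b]
    rwa [funMap_mul, funMap_mul] at this

theorem toAddHom_apply (f : M ↪[cog] N) (a : M) : toAddHom f a = f a := rfl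

theorem toAddHom_strictMono (f : M ↪[cog] N) : StrictMono (toAddHom f) := by
  intro a b hab
  rw [cut_lt_iff] at hab ⊢
  rcases hab with ⟨rfl, h⟩ | h
  · exact .inl ⟨map_zero _, fun hb => h (f.injective (hb.trans (map_zero (toAddHom f)).symm))⟩
  · right
    have := (map_rel_iff f).2 h
    rwa [← toAddHom_apply, map_zero] at this

namespace Unwound

/-- Every abelian cyclically ordered group thus arises as a quotient of an ordered group. -/
theorem isUnwinding : IsUnwinding (turn : Unwound M) (proj : Unwound M → M) where
  pos := turn_pos
  bdd x := ⟨x.turns + 1, by rw [zsmul_turn, lt_iff]; left; simp⟩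
  surj a := ⟨⟨0, a⟩, rfl⟩
  map_eq {x y} := by
    simp only [add_zsmul_turn, proj_apply, Unwound.ext_iff]
    exact ⟨fun h => ⟨x.turns - y.turns, by omega, h⟩, fun ⟨n, _, h⟩ => h⟩
  map_one := (funMap_one _).trans (map_zero proj).symm
  map_inv x := (funMap_inv _).trans (map_neg proj x).symm
  map_mul x y := (funMap_mul _).trans (map_add proj x y).symm
  rel {x y t} := by
    have hx : x + (turn : Unwound M) = ⟨x.turns + 1, x.pt⟩ := by simpa using add_zsmul_turn x 1
    simp only [hx, add_zsmul_turn, proj_apply, lt_iff, rel_iff]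
    constructor
    -- The integers move `y` and `t` to the turn of `x`, or to the next turn when they precede `x`
    -- in the cut order.
    · rintro (⟨h, h'⟩ | ⟨h, h'⟩ | ⟨h, h'⟩)
      · exact ⟨x.turns - y.turns, x.turns - t.turns, .inr ⟨by omega, h⟩, .inr ⟨by omega, h'⟩,
          .inl (by omega)⟩
      · exact ⟨x.turns - y.turns + 1, x.turns - t.turns + 1, .inl (by omega),
          .inr ⟨by omega, h⟩, .inr ⟨by omega, h'⟩⟩
      · exact ⟨x.turns - y.turns, x.turns - t.turns + 1, .inr ⟨by omega, h'⟩, .inl (by omega),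
          .inr ⟨by omega, h⟩⟩
    · rintro ⟨m, n, h1 | ⟨h1, h1'⟩, h2 | ⟨h2, h2'⟩, h3 | ⟨h3, h3'⟩⟩ <;>
        first
        | (exfalso; omega)
        | tauto

/-- The morphism of unwound groups induced by an embedding. -/
noncomputable def map (f : M ↪[cog] N) : Unwound M →+ Unwound N :=
  AddMonoidHom.mk' (fun x => ⟨x.turns, toAddHom f x.pt⟩) fun x y => by
    -- Carries are comparisons in the cut order, which an embedding preserves; hence the turns add
    -- up in the same way.
    refine Unwound.ext ?_ (map_add (toAddHom f) _ _)
    simp only [turns_add, carry, ← map_add, (toAddHom_strictMono f).lt_iff_lt]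

theorem map_strictMono (f : M ↪[cog] N) : StrictMono (map f) := by
  intro x y h
  rw [lt_iff] at h ⊢
  exact h.imp_right (And.imp_right fun h => toAddHom_strictMono f h)

theorem map_turn (f : M ↪[cog] N) : map f turn = turn :=
  Unwound.ext rfl (map_zero (toAddHom f))

end Unwound

end Embedding

/-! ### Models of `TcD` and divisibility of the unwound -/

section TcDModels

variable {M : Type u} [cog.Structure M]

theorem realize_powT [M ⊨ abelianCog] {α : Type} (t : cog.Term α) (v : α → M) (n : ℕ) :
    (powT t n).realize v = n • t.realize v := by
  induction n with
  | zero => simp only [powT, realize_oneT, zero_smul, funMap_one]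
  | succ n ih =>
    rw [powT, realize_mulT, funMap_mul, succ_nsmul, ← ih]
    rfl

theorem model_divisibility_iff [M ⊨ abelianCog] :
    M ⊨ divisibility ↔ ∀ n : ℕ, n ≠ 0 → ∀ a : M, ∃ b, n • b = a := by
  simp only [Theory.model_iff, divisibility, Set.mem_ofPred_eq, forall_exists_index, and_imp]
  constructor
  · intro h n hn
    have := h _ n (Nat.one_le_iff_ne_zero.2 hn) rfl
    simpa [Sentence.Realize, Formula.Realize, realize_powT, Fin.snoc] using this
  · rintro h φ n hn rfl
    have := h n (Nat.one_le_iff_ne_zero.1 hn)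
    simpa [Sentence.Realize, Formula.Realize, realize_powT, Fin.snoc] using this

theorem model_primeTorsion_iff [M ⊨ abelianCog] :
    M ⊨ primeTorsion ↔ ∀ p : ℕ, p.Prime → ∃ a : M, a ≠ 0 ∧ p • a = 0 := by
  have h1 : Structure.funMap oneF ![] = (0 : M) := funMap_one _
  simp only [Theory.model_iff, primeTorsion, Set.mem_ofPred_eq, forall_exists_index, and_imp]
  constructor
  · intro h p hp
    have := h _ p hp rfl
    simpa [Sentence.Realize, Formula.Realize, realize_powT, realize_oneT, Fin.snoc, h1] using this
  · rintro h φ p hp rfl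
    have := h p hp
    simpa [Sentence.Realize, Formula.Realize, realize_powT, realize_oneT, Fin.snoc, h1] using this

theorem model_TcD_iff [M ⊨ abelianCog] :
    M ⊨ TcD ↔ (∀ n : ℕ, n ≠ 0 → ∀ a : M, ∃ b, n • b = a) ∧
      ∀ p : ℕ, p.Prime → ∃ a : M, a ≠ 0 ∧ p • a = 0 := by
  rw [TcD, Theory.model_union_iff, Theory.model_union_iff, model_divisibility_iff,
    model_primeTorsion_iff]
  tauto

instance abelianCog_of_TcD [h : M ⊨ TcD] : M ⊨ abelianCog :=
  h.mono fun _ hφ => .inl (.inl hφ)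

/-- Roots descend from `Γ`, and the image of `z / p` has order `p`: it is nonzero because `0 < z / p
< z`. -/
theorem IsUnwinding.model_TcD {Γ : Type v} [AddCommGroup Γ] [LinearOrder Γ] [IsOrderedAddMonoid Γ]
    {z : Γ} {π : Γ → M} (h : IsUnwinding z π) (hdiv : ∀ n : ℕ, n ≠ 0 → ∀ x : Γ, ∃ y, n • y = x) :
    M ⊨ TcD := by
  have hmod := h.model
  refine model_TcD_iff.2 ⟨fun n hn a => ?_, fun p hp => ?_⟩
  · obtain ⟨x, rfl⟩ := h.surj a
    obtain ⟨y, rfl⟩ := hdiv n hn x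
    exact ⟨π y, (h.map_nsmul n y).symm⟩
  · obtain ⟨y, hy⟩ := hdiv p hp.ne_zero z
    have h0 : π 0 = 0 := by simpa using h.map_nsmul 0 0
    refine ⟨π y, fun hy0 => ?_, ?_⟩
    · have hpos : 0 < y := by
        have := h.pos
        rw [← hy] at this
        exact (nsmul_pos_iff hp.ne_zero).1 this
      refine h.not_lt_of_eq (h0.trans hy0.symm) hpos ?_
      rw [zero_add, ← hy]
      simpa using nsmul_lt_nsmul_left hpos hp.one_lt
    · rw [← h.map_nsmul, hy, ← h0, ← h.map_add_zsmul 0 1]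
      simp

/-- It suffices to divide by primes. Divisibility of `M` divides `x` by `p` up to a multiple of
`turn`, so the point is to divide `turn` itself, and this is where `p`-torsion enters. -/
theorem Unwound.divisible [hM : M ⊨ TcD] (n : ℕ) (hn : n ≠ 0) (x : Unwound M) :
    ∃ y, n • y = x := by
  obtain ⟨hdiv, htor⟩ := model_TcD_iff.1 hM
  induction n using Nat.recOnMul generalizing x with
  | zero => exact absurd rfl hn
  | one => exact ⟨x, one_smul _ _⟩
  | prime p hp =>
    obtain ⟨y, hy⟩ : ∃ y : Unwound M, p • y = turn := by
      obtain ⟨a, ha, hpa⟩ := htor p hp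
      let y : Unwound M := ⟨0, a⟩
      have hy : 0 < y := lt_iff.2 (.inr ⟨rfl, (cut_zero_le a).lt_of_ne ha.symm⟩)
      have hy' : y < turn := lt_iff.2 (.inl Int.zero_lt_one)
      -- The lift `y` of the torsion element satisfies `p • y = j • turn` with `0 < j < p`. As `j`
      -- is prime to `p`, a Bézout relation `r p + s j = 1` yields the root `r • turn + s • y`.
      obtain ⟨j, hj⟩ := isUnwinding.map_eq.1 (show proj (p • y) = proj 0 by
        rw [map_nsmul, map_zero]; exact hpa)
      rw [zero_add] at hj
      have h1 : (0 : ℤ) • (turn : Unwound M) < j • turn := by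
        rw [zero_smul, ← hj]
        exact nsmul_pos hy hn
      have h2 : j • (turn : Unwound M) < (p : ℤ) • turn := by
        rw [← hj, natCast_zsmul]
        exact nsmul_lt_nsmul_right hn hy'
      have h1 := (zsmul_lt_zsmul_iff_left turn_pos).1 h1
      have h2 := (zsmul_lt_zsmul_iff_left turn_pos).1 h2
      obtain ⟨r, s, hrs⟩ := (Irreducible.coprime_iff_not_dvd (Nat.prime_iff_prime_int.1 hp).irreducible
        (n := j)).2 fun h => (Int.le_of_dvd h1 h).not_gt h2
      refine ⟨r • turn + s • y, ?_⟩
      rw [smul_add, smul_comm p s, hj, ← natCast_zsmul, smul_smul, smul_smul, ← add_smul,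
        mul_comm, hrs, one_smul]
    obtain ⟨b, hb⟩ := hdiv p hn x.pt
    obtain ⟨k, hk⟩ := isUnwinding.map_eq.1 (show proj x = proj (p • (⟨0, b⟩ : Unwound M)) by
      rw [map_nsmul]; exact hb.symm)
    exact ⟨⟨0, b⟩ + k • y, by rw [smul_add, smul_comm, hy, hk]⟩
  | mul a b iha ihb =>
    obtain ⟨y, hy⟩ := iha (left_ne_zero_of_mul hn) x
    obtain ⟨y', hy'⟩ := ihb (right_ne_zero_of_mul hn) y
    exact ⟨y', by rw [mul_smul, hy', hy]⟩

end TcDModels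

/-! ### Extending ordered morphisms to essential extensions -/

section Extension

variable {Γ D Γ' : Type*} [AddCommGroup Γ] [LinearOrder Γ] [IsOrderedAddMonoid Γ]
  [AddCommGroup D] [LinearOrder D] [IsOrderedAddMonoid D]
  [AddCommGroup Γ'] [LinearOrder Γ'] [IsOrderedAddMonoid Γ']

omit [IsOrderedAddMonoid Γ] in
/-- A morphism to a divisible ordered group extends to any group in which the source is essential:
every element has a multiple in the source. -/
theorem exists_extension {j : Γ →+ D} (hj : StrictMono j)
    (hD : ∀ d, ∃ k : ℕ, k ≠ 0 ∧ ∃ x, k • d = j x) {φ : Γ →+ Γ'} (hφ : StrictMono φ)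
    (hdiv : ∀ n : ℕ, n ≠ 0 → ∀ x : Γ', ∃ y, n • y = x) :
    ∃ ψ : D →+ Γ', StrictMono ψ ∧ ∀ x, ψ (j x) = φ x := by
  have key : ∀ d, ∃ y, ∃ k : ℕ, k ≠ 0 ∧ ∃ x, k • d = j x ∧ k • y = φ x := fun d => by
    obtain ⟨k, hk, x, hx⟩ := hD d
    obtain ⟨y, hy⟩ := hdiv k hk (φ x)
    exact ⟨y, k, hk, x, hx, hy⟩
  -- The chosen value does not depend on `k` and `x`: after passing to the common multiple `k' * k`,
  -- torsion-freeness of an ordered group forces uniqueness. Additivity and the extension property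
  -- follow from this uniqueness.
  choose ψ hψ using key
  have cross : ∀ (k k' : ℕ) (d d' : D) (x x' : Γ), k • d = j x → k' • d' = j x' →
      (k' * k) • d = j (k' • x) ∧ (k' * k) • d' = j (k • x') := fun k k' d d' x x' h h' =>
    ⟨by rw [mul_smul, h, map_nsmul], by rw [mul_comm, mul_smul, h', map_nsmul]⟩
  have lt_of_lt : ∀ d d' y y', d < d' → (∃ k : ℕ, k ≠ 0 ∧ ∃ x, k • d = j x ∧ k • y = φ x) →
      (∃ k : ℕ, k ≠ 0 ∧ ∃ x, k • d' = j x ∧ k • y' = φ x) → y < y' := by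
    rintro d d' y y' hlt ⟨k, hk, x, h1, h2⟩ ⟨k', hk', x', h1', h2'⟩
    obtain ⟨e1, e2⟩ := cross k k' d d' x x' h1 h1'
    have h3 : (k' * k) • y = φ (k' • x) := by rw [mul_smul, h2, map_nsmul]
    have h4 : (k' * k) • y' = φ (k • x') := by rw [mul_comm, mul_smul, h2', map_nsmul]
    have h0 : k' * k ≠ 0 := mul_ne_zero hk' hk
    have := nsmul_lt_nsmul_right h0 hlt
    rw [e1, e2, hj.lt_iff_lt] at this
    have := hφ this
    rw [← h3, ← h4] at this
    exact lt_of_nsmul_lt_nsmul_right _ this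
  have eq_of : ∀ d y y', (∃ k : ℕ, k ≠ 0 ∧ ∃ x, k • d = j x ∧ k • y = φ x) →
      (∃ k : ℕ, k ≠ 0 ∧ ∃ x, k • d = j x ∧ k • y' = φ x) → y = y' := by
    rintro d y y' ⟨k, hk, x, h1, h2⟩ ⟨k', hk', x', h1', h2'⟩
    obtain ⟨e1, e2⟩ := cross k k' d d x x' h1 h1'
    have h3 : (k' * k) • y = φ (k' • x) := by rw [mul_smul, h2, map_nsmul]
    have h4 : (k' * k) • y' = φ (k • x') := by rw [mul_comm, mul_smul, h2', map_nsmul]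
    rw [e1, hj.injective.eq_iff] at e2
    rw [e2, ← h4] at h3
    exact nsmul_right_injective (mul_ne_zero hk' hk) h3
  refine ⟨AddMonoidHom.mk' ψ fun d d' => ?_, fun d d' h => lt_of_lt d d' _ _ h (hψ d) (hψ d'),
    fun x => eq_of (j x) _ _ (hψ _) ⟨1, one_ne_zero, x, one_smul _ _, one_smul _ _⟩⟩
  refine eq_of (d + d') _ _ (hψ _) ?_
  obtain ⟨k, hk, x, h1, h2⟩ := hψ d
  obtain ⟨k', hk', x', h1', h2'⟩ := hψ d'
  refine ⟨k' * k, mul_ne_zero hk' hk, k' • x + k • x', ?_, ?_⟩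
  · obtain ⟨e1, e2⟩ := cross k k' d d' x x' h1 h1'
    rw [smul_add, e1, e2, map_add]
  · rw [smul_add, mul_smul, h2, mul_comm, mul_smul, h2', map_add, map_nsmul, map_nsmul]

end Extension

/-! ### The group `T(𝕌)` as `ℚ/ℤ` -/

section RootsOfUnity

/-- The root of unity `exp(2πiq)`. -/
noncomputable def rootOfUnity (q : ℚ) : TU :=
  ⟨Circle.exp (2 * Real.pi * q), isOfFinOrder_iff_pow_eq_one.2 ⟨q.den, q.den_pos, by
    rw [← Circle.exp_nsmul, Circle.exp_eq_one]
    refine ⟨q.num, ?_⟩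
    have h : (q.den : ℝ) * (q : ℝ) = q.num := by exact_mod_cast Rat.den_mul_eq_num q
    rw [nsmul_eq_mul, ← h]
    ring⟩⟩

theorem exp_two_pi_eq_iff {x y : ℝ} :
    Circle.exp (2 * Real.pi * x) = Circle.exp (2 * Real.pi * y) ↔ ∃ n : ℤ, x = y + n := by
  rw [Circle.exp_eq_exp]
  have hpi := Real.pi_pos
  refine exists_congr fun n => ?_
  constructor
  · intro h
    have : 2 * Real.pi * x = 2 * Real.pi * (y + n) := by linarith
    exact mul_left_cancel₀ (by positivity) this
  · rintro rfl
    ring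

theorem rootOfUnity_surjective : Function.Surjective rootOfUnity := by
  rintro ⟨ζ, hζ⟩
  obtain ⟨n, hn, h⟩ := isOfFinOrder_iff_pow_eq_one.1 hζ
  obtain ⟨t, rfl⟩ : ∃ t, Circle.exp t = ζ := ⟨_, Circle.exp_arg ζ⟩
  rw [← Circle.exp_nsmul, Circle.exp_eq_one] at h
  obtain ⟨k, hk⟩ := h
  refine ⟨k / n, Subtype.ext (congrArg Circle.exp ?_)⟩
  have : (n : ℝ) ≠ 0 := by positivity
  rw [nsmul_eq_mul] at hk
  push_cast
  field_simp
  linarith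

theorem circleR_exp_iff (x y t : ℚ) :
    circleR (Circle.exp (2 * Real.pi * x)) (Circle.exp (2 * Real.pi * y))
        (Circle.exp (2 * Real.pi * t)) ↔
      ∃ m n : ℤ, x < y + m ∧ y + m < t + n ∧ t + n < x + 1 := by
  have hpi : 0 < 2 * Real.pi := by positivity
  constructor
  · rintro ⟨X, Y, Z, hX, hY, hZ, eX, eY, eZ, h⟩
    have scale : ∀ (X : ℝ) (x : ℚ), X ∈ Set.Ico 0 (2 * Real.pi) →
        Circle.exp X = Circle.exp (2 * Real.pi * x) →
        ∃ a : ℤ, X = 2 * Real.pi * (x + a : ℚ) ∧ 0 ≤ x + a ∧ x + a < 1 := by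
      intro X x hX eX
      obtain ⟨a, ha⟩ := Circle.exp_eq_exp.1 eX
      have ha : X = 2 * Real.pi * (x + a : ℚ) := by
        push_cast
        linarith
      refine ⟨a, ha, ?_, ?_⟩
      · have := hX.1
        rw [ha] at this
        exact_mod_cast nonneg_of_mul_nonneg_right this hpi
      · have := hX.2
        rw [ha] at this
        exact_mod_cast (mul_lt_iff_lt_one_right hpi).1 this
    obtain ⟨a, rfl, ha, ha'⟩ := scale X x hX eX
    obtain ⟨b, rfl, hb, hb'⟩ := scale Y y hY eY
    obtain ⟨c, rfl, hc, hc'⟩ := scale Z t hZ eZ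
    simp only [mul_lt_mul_iff_right₀ hpi, Rat.cast_lt] at h
    rcases h with ⟨h, h'⟩ | ⟨h, h'⟩ | ⟨h, h'⟩
    · refine ⟨b - a, c - a, ?_, ?_, ?_⟩ <;> push_cast <;> linarith
    · refine ⟨b - a + 1, c - a + 1, ?_, ?_, ?_⟩ <;> push_cast <;> linarith
    · refine ⟨b - a, c - a + 1, ?_, ?_, ?_⟩ <;> push_cast <;> linarith
  · rintro ⟨m, n, h1, h2, h3⟩
    have frac : ∀ x : ℚ, 2 * Real.pi * (Int.fract x : ℚ) ∈ Set.Ico 0 (2 * Real.pi) ∧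
        Circle.exp (2 * Real.pi * (Int.fract x : ℚ)) = Circle.exp (2 * Real.pi * x) := by
      intro x
      refine ⟨⟨mul_nonneg hpi.le (by exact_mod_cast Int.fract_nonneg x),
        mul_lt_of_lt_one_right hpi (by exact_mod_cast Int.fract_lt_one x)⟩, ?_⟩
      rw [exp_two_pi_eq_iff]
      refine ⟨-⌊x⌋, ?_⟩
      have : Int.fract x = x + (-⌊x⌋ : ℤ) := by
        rw [Int.fract]
        push_cast
        ring
      exact_mod_cast congrArg (Rat.cast (K := ℝ)) this
    refine ⟨_, _, _, (frac x).1, (frac y).1, (frac t).1, (frac x).2, (frac y).2, (frac t).2, ?_⟩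
    simp only [mul_lt_mul_iff_right₀ hpi, Rat.cast_lt]
    have ex := Int.fract_add_floor x
    have ey := Int.fract_add_floor y
    have et := Int.fract_add_floor t
    have hx := Int.fract_nonneg x
    have hy := Int.fract_nonneg y
    have ht := Int.fract_nonneg t
    have hx' := Int.fract_lt_one x
    have hy' := Int.fract_lt_one y
    have ht' := Int.fract_lt_one t
    -- In terms of fractional parts the hypothesis reads `fract x < fract y + p < fract t + q <
    -- fract x + 1`, which leaves `p` and `q` only the values `0` and `1`. The pair `p = 1`, `q = 0`
    -- is impossible; the other three are the three rotations in `circleR`.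
    obtain ⟨p, hp⟩ : ∃ p : ℤ, p = ⌊y⌋ + m - ⌊x⌋ := ⟨_, rfl⟩
    obtain ⟨q, hq⟩ : ∃ q : ℤ, q = ⌊t⌋ + n - ⌊x⌋ := ⟨_, rfl⟩
    have hp' : (p : ℚ) = ⌊y⌋ + m - ⌊x⌋ := by rw [hp]; push_cast; ring
    have hq' : (q : ℚ) = ⌊t⌋ + n - ⌊x⌋ := by rw [hq]; push_cast; ring
    have p1 : -1 < p := by
      have : (-1 : ℚ) < p := by linarith
      exact_mod_cast this
    have p2 : p < 2 := by
      have : (p : ℚ) < 2 := by linarith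
      exact_mod_cast this
    have q1 : -1 < q := by
      have : (-1 : ℚ) < q := by linarith
      exact_mod_cast this
    have q2 : q < 2 := by
      have : (q : ℚ) < 2 := by linarith
      exact_mod_cast this
    obtain rfl | rfl : p = 0 ∨ p = 1 := by omega
    · obtain rfl | rfl : q = 0 ∨ q = 1 := by omega
      · left
        push_cast at hp' hq'
        constructor <;> linarith
      · right; right
        push_cast at hp' hq'
        constructor <;> linarith
    · obtain rfl | rfl : q = 0 ∨ q = 1 := by omega
      · exfalso
        push_cast at hp' hq'
        linarith
      · right; left
        push_cast at hp' hq'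
        constructor <;> linarith

theorem isUnwinding_rootOfUnity : IsUnwinding (1 : ℚ) rootOfUnity where
  pos := one_pos
  bdd x := ⟨⌊x⌋ + 1, by simp⟩
  surj := rootOfUnity_surjective
  map_eq {x y} := by
    rw [Subtype.ext_iff]
    refine exp_two_pi_eq_iff.trans (exists_congr fun n => ?_)
    rw [zsmul_one]
    norm_cast
  map_one := Subtype.ext (by
    change (1 : Circle) = Circle.exp (2 * Real.pi * (0 : ℚ))
    simp)
  map_inv x := Subtype.ext (by
    change (Circle.exp (2 * Real.pi * x))⁻¹ = Circle.exp (2 * Real.pi * (-x : ℚ))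
    rw [← Circle.exp_neg]
    push_cast
    ring_nf)
  map_mul x y := Subtype.ext (by
    change Circle.exp (2 * Real.pi * x) * Circle.exp (2 * Real.pi * y) =
      Circle.exp (2 * Real.pi * (x + y : ℚ))
    rw [← Circle.exp_add]
    push_cast
    ring_nf)
  rel {x y t} := by
    simp only [zsmul_one]
    exact circleR_exp_iff x y t

theorem model_TcD_TU : TU ⊨ TcD :=
  isUnwinding_rootOfUnity.model_TcD fun n hn x => ⟨x / n, by
    rw [nsmul_eq_mul]
    field_simp⟩

/-- The morphism `ℤ → Unwound M` sending `1` to `turn` extends to `ℚ` by divisibility; it descends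
modulo `1` and `turn`. -/
theorem nonempty_TU_embedding {M : Type u} [cog.Structure M] [M ⊨ TcD] : Nonempty (TU ↪[cog] M) := by
  obtain ⟨ψ, hψ, h⟩ := exists_extension (Γ := ℤ) (D := ℚ) (Γ' := Unwound M)
    (j := Int.castAddHom ℚ) Int.cast_strictMono
    (fun d => ⟨d.den, d.den_ne_zero, d.num, by
      rw [nsmul_eq_mul]
      exact Rat.den_mul_eq_num d⟩)
    (φ := (zmultiplesHom (Unwound M)) Unwound.turn)
    (fun m n h => (zsmul_lt_zsmul_iff_left Unwound.turn_pos).2 h) Unwound.divisible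
  obtain ⟨f, -⟩ := isUnwinding_rootOfUnity.exists_embedding Unwound.isUnwinding ψ hψ (by
    simpa using h 1)
  exact ⟨f⟩

theorem model_TcD_iff_isCDivisible (M : Type u) [cog.Structure M] : M ⊨ TcD ↔ IsCDivisible M := by
  constructor
  · intro h
    exact ⟨abelianCog_of_TcD, h.mono fun _ hφ => .inl (.inr hφ), nonempty_TU_embedding⟩
  · rintro ⟨h, hdiv, ⟨f⟩⟩
    have hTU := model_TcD_TU
    refine model_TcD_iff.2 ⟨model_divisibility_iff.1 hdiv, fun p hp => ?_⟩
    obtain ⟨a, ha, hpa⟩ := (model_TcD_iff.1 hTU).2 p hp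
    refine ⟨toAddHom f a, fun h0 => ha (f.injective (h0.trans (map_zero (toAddHom f)).symm)), ?_⟩
    rw [← map_nsmul, hpa, map_zero]

end RootsOfUnity

/-! ### The c-divisible hull -/

section Hull

variable {Γ : Type u} [AddCommGroup Γ]

/-- The quotient of an ordered group by the subgroup generated by `z`, with the induced cyclic
order. -/
def Winding (z : Γ) : Type u := Γ ⧸ AddSubgroup.zmultiples z

/-- The quotient map. -/
def Winding.mk (z : Γ) (x : Γ) : Winding z := QuotientAddGroup.mk x

theorem Winding.mk_surjective (z : Γ) : Function.Surjective (Winding.mk z) :=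
  QuotientAddGroup.mk_surjective

theorem Winding.mk_eq_iff {z x y : Γ} : mk z x = mk z y ↔ ∃ n : ℤ, x = y + n • z := by
  rw [eq_comm]
  refine QuotientAddGroup.eq.trans (AddSubgroup.mem_zmultiples_iff.trans (exists_congr fun n => ?_))
  rw [eq_neg_add_iff_add_eq, eq_comm]

variable [LinearOrder Γ]

/-- The operations use arbitrary representatives; `Winding.isUnwinding` shows that the choice is
immaterial when `z` is positive and cofinal. -/
noncomputable instance (z : Γ) : cog.Structure (Winding z) where
  funMap := fun {_} f => match f with
    | .one => fun _ => Winding.mk z 0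
    | .inv => fun v => Winding.mk z (-(Function.surjInv (Winding.mk_surjective z) (v 0)))
    | .mul => fun v => Winding.mk z (Function.surjInv (Winding.mk_surjective z) (v 0) +
        Function.surjInv (Winding.mk_surjective z) (v 1))
  RelMap := fun {_} r => match r with
    | .R => fun v => ∃ x y t : Γ, Winding.mk z x = v 0 ∧ Winding.mk z y = v 1 ∧
        Winding.mk z t = v 2 ∧ x < y ∧ y < t ∧ t < x + z

theorem Winding.isUnwinding [IsOrderedAddMonoid Γ] {z : Γ} (hz : 0 < z)
    (hb : ∀ x : Γ, ∃ n : ℤ, x < n • z) : IsUnwinding z (Winding.mk z) where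
  pos := hz
  bdd := hb
  surj := Winding.mk_surjective z
  map_eq := Winding.mk_eq_iff
  map_one := rfl
  map_inv x := by
    obtain ⟨n, hn⟩ := Winding.mk_eq_iff.1 (Function.surjInv_eq (Winding.mk_surjective z) (mk z x))
    refine Winding.mk_eq_iff.2 ⟨-n, ?_⟩
    change -(Function.surjInv (Winding.mk_surjective z) (mk z x)) = _
    rw [hn, neg_smul]
    abel
  map_mul x y := by
    obtain ⟨n, hn⟩ := Winding.mk_eq_iff.1 (Function.surjInv_eq (Winding.mk_surjective z) (mk z x))
    obtain ⟨m, hm⟩ := Winding.mk_eq_iff.1 (Function.surjInv_eq (Winding.mk_surjective z) (mk z y))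
    refine Winding.mk_eq_iff.2 ⟨n + m, ?_⟩
    change Function.surjInv (Winding.mk_surjective z) (mk z x) +
      Function.surjInv (Winding.mk_surjective z) (mk z y) = _
    rw [hn, hm, add_smul]
    abel
  rel {x y t} := by
    constructor
    · rintro ⟨x', y', t', hx, hy, ht, h1, h2, h3⟩
      obtain ⟨a, rfl⟩ := Winding.mk_eq_iff.1 hx
      obtain ⟨b, rfl⟩ := Winding.mk_eq_iff.1 hy
      obtain ⟨c, rfl⟩ := Winding.mk_eq_iff.1 ht
      refine ⟨b - a, c - a, ?_, ?_, ?_⟩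
      · rw [sub_smul, ← add_sub_assoc]
        exact lt_sub_iff_add_lt.2 h1
      · rw [sub_smul, sub_smul, ← add_sub_assoc, ← add_sub_assoc]
        exact sub_lt_sub_right h2 _
      · rw [sub_smul, ← add_sub_assoc, sub_lt_iff_lt_add, add_right_comm]
        exact h3
    · rintro ⟨m, n, h1, h2, h3⟩
      exact ⟨x, y + m • z, t + n • z, rfl, Winding.mk_eq_iff.2 ⟨m, rfl⟩,
        Winding.mk_eq_iff.2 ⟨n, rfl⟩, h1, h2, h3⟩

/-- An embedding of `G` in `H` is essential if every element of `H` has a nonzero multiple in the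
image of `G`. -/
def IsEssential {G : Type v} {H : Type w} [cog.Structure G] [cog.Structure H] [H ⊨ abelianCog]
    (i : G ↪[cog] H) : Prop :=
  ∀ x : H, ∃ k : ℕ, k ≠ 0 ∧ ∃ g, k • x = i g

/-- Essentiality lifts with the same multiple, since the lifted embedding leaves the number of turns
free. -/
theorem IsEssential.unwound {G : Type v} {H : Type w} [cog.Structure G] [cog.Structure H]
    [G ⊨ abelianCog] [H ⊨ abelianCog] {i : G ↪[cog] H} (hi : IsEssential i) (x : Unwound H) :
    ∃ k : ℕ, k ≠ 0 ∧ ∃ y, k • x = Unwound.map i y := by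
  obtain ⟨k, hk, g, hg⟩ := hi x.pt
  exact ⟨k, hk, ⟨(k • x).turns, g⟩, Unwound.ext rfl ((map_nsmul Unwound.proj k x).trans hg)⟩

/-- The divisible hull of `Unwound G`, divided by the image of `turn`. -/
theorem exists_essential_embedding (G : Type u) [cog.Structure G] [G ⊨ abelianCog] :
    ∃ (H : Type u) (_ : cog.Structure H) (_ : H ⊨ TcD) (i : G ↪[cog] H), IsEssential i := by
  let j := DivisibleHull.coeOrderAddMonoidHom (Unwound G)
  have hj : StrictMono j := j.monotone'.strictMono_of_injective DivisibleHull.coe_injective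
  have hD : ∀ d : DivisibleHull (Unwound G), ∃ k : ℕ, k ≠ 0 ∧ ∃ x, k • d = j x := fun d => by
    induction d with
    | mk m s =>
      refine ⟨s, s.ne_zero, m, ?_⟩
      rw [DivisibleHull.nsmul_mk]
      exact DivisibleHull.mk_eq_mk_iff_smul_eq_smul.2 (by simp)
  have hdiv : ∀ n : ℕ, n ≠ 0 → ∀ x : DivisibleHull (Unwound G), ∃ y, n • y = x := fun n hn x => by
    refine ⟨(n : ℚ)⁻¹ • x, ?_⟩
    rw [← Nat.cast_smul_eq_nsmul ℚ, smul_inv_smul₀ (by exact_mod_cast hn)]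
  have hz : 0 < j Unwound.turn := by
    rw [← map_zero j]
    exact hj Unwound.turn_pos
  have hb : ∀ x, ∃ n : ℤ, x < n • j Unwound.turn := fun x => by
    -- Replacing `x` by `max x 0` gives a nonnegative element, which is at most its own multiple by
    -- `k`; that multiple lies in `Unwound G`, where `turn` is cofinal.
    obtain ⟨k, hk, y, hy⟩ := hD (max x 0)
    obtain ⟨n, hn⟩ := Unwound.isUnwinding.bdd y
    refine ⟨n, (le_max_left x 0).trans_lt ?_⟩
    calc max x 0 ≤ k • max x 0 := by
          simpa using nsmul_le_nsmul_left (le_max_right x 0) (Nat.one_le_iff_ne_zero.2 hk)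
      _ = j y := hy
      _ < _ := by
          rw [← map_zsmul]
          exact hj hn
  have hW := Winding.isUnwinding hz hb
  have hT := hW.model_TcD hdiv
  obtain ⟨i, hi⟩ := Unwound.isUnwinding.exists_embedding hW (j : Unwound G →+ _) hj rfl
  refine ⟨Winding (j Unwound.turn), inferInstance, hT, i, fun x => ?_⟩
  obtain ⟨d, rfl⟩ := hW.surj x
  obtain ⟨k, hk, y, hy⟩ := hD d
  refine ⟨k, hk, Unwound.proj y, ?_⟩
  rw [hi, ← hW.map_nsmul, hy]
  rfl

theorem IsEssential.existsUnique_extension {G : Type u} {H : Type v} {K : Type w} [cog.Structure G]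
    [cog.Structure H] [cog.Structure K] [G ⊨ abelianCog] [H ⊨ abelianCog] [K ⊨ TcD]
    {i : G ↪[cog] H} (hi : IsEssential i) (f : G ↪[cog] K) : ∃! h : H ↪[cog] K, h.comp i = f := by
  obtain ⟨ψ, hψ, hψf⟩ := exists_extension (Unwound.map_strictMono i) hi.unwound
    (Unwound.map_strictMono f) Unwound.divisible
  obtain ⟨h, hh⟩ := Unwound.isUnwinding.exists_embedding Unwound.isUnwinding ψ hψ (by
    rw [← Unwound.map_turn i, hψf, Unwound.map_turn])
  refine ⟨h, ?_, fun h' hh' => ?_⟩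
  · ext g
    have := hh (Unwound.map i ⟨0, g⟩)
    rw [hψf] at this
    exact this
  · have hcomp : ∀ g, h (i g) = f g := fun g => by
      have := hh (Unwound.map i ⟨0, g⟩)
      rw [hψf] at this
      exact this
    ext x
    obtain ⟨k, hk, y, hy⟩ := hi.unwound ⟨0, x⟩
    -- The comparison takes place in the unwound of `K`, which is torsion-free; `K` itself has
    -- torsion, so agreement on a multiple of `x` would not be enough there.
    have e : Unwound.map h' ⟨0, x⟩ = Unwound.map h ⟨0, x⟩ := by
      refine nsmul_right_injective hk ?_
      have hcomp' : ∀ g, h' (i g) = f g := fun g => DFunLike.congr_fun hh' g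
      change k • Unwound.map h' ⟨0, x⟩ = k • Unwound.map h ⟨0, x⟩
      rw [← map_nsmul, ← map_nsmul, hy]
      refine Unwound.ext rfl ?_
      change h' (i y.pt) = h (i y.pt)
      rw [hcomp', hcomp]
    exact congrArg Unwound.pt e

theorem IsEssential.isCDivisibleHull {G H : Type u} [cog.Structure G] [cog.Structure H]
    [G ⊨ abelianCog] [hH : H ⊨ TcD] {i : G ↪[cog] H} (hi : IsEssential i) : IsCDivisibleHull i := by
  refine ⟨(model_TcD_iff_isCDivisible H).1 hH, fun S hS hG => ?_, fun K _ hK f => ?_⟩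
  · have hS' := (model_TcD_iff_isCDivisible S).2 hS
    refine eq_top_iff.2 fun x _ => ?_
    obtain ⟨k, hk, y, hy⟩ := hi.unwound ⟨0, x⟩
    -- The lift of `x` is the only `k`-th root of its multiple in the unwound of `H`; the unwound of
    -- `S` is divisible, so it already contains such a root.
    obtain ⟨w, hw⟩ := Unwound.divisible k hk (⟨y.turns, ⟨i y.pt, hG ⟨_, rfl⟩⟩⟩ : Unwound S)
    have e : Unwound.map S.subtype w = ⟨0, x⟩ := by
      refine nsmul_right_injective hk ?_
      simp only [hy, ← map_nsmul, hw]
      rfl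
    have e' : (w.pt : H) = x := congrArg Unwound.pt e
    exact e' ▸ w.pt.2
  · have hK' := (model_TcD_iff_isCDivisible K).2 hK
    exact hi.existsUnique_extension f

end Hull

/-! ### Pulling back witnesses to a c-divisible subgroup -/

section ExistentiallyClosed

variable {H : Type u} {M : Type v} [cog.Structure H] [cog.Structure M]

section Cut

variable [H ⊨ abelianCog] [M ⊨ abelianCog] (f : H ↪[cog] M)

/-- The filter on the unwound of `H` generated by the intervals around an element of the unwound of
an extension of `H`. -/
def cutFilter (x : Unwound M) : Filter (Unwound H) where
  sets := {s | ∃ l u, Unwound.map f l < x ∧ x < Unwound.map f u ∧ ∀ y, l < y → y < u → y ∈ s}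
  univ_sets := by
    obtain ⟨n, hn⟩ := Unwound.isUnwinding.bdd x
    obtain ⟨m, hm⟩ := Unwound.isUnwinding.bdd (-x)
    refine ⟨-(m • Unwound.turn), n • Unwound.turn, ?_, ?_, fun _ _ _ => trivial⟩
    · rw [map_neg, map_zsmul, Unwound.map_turn]
      exact neg_lt.1 hm
    · rwa [map_zsmul, Unwound.map_turn]
  sets_of_superset := by
    rintro s t ⟨l, u, hl, hu, h⟩ hst
    exact ⟨l, u, hl, hu, fun y h1 h2 => hst (h y h1 h2)⟩
  inter_sets := by
    rintro s t ⟨l, u, hl, hu, h⟩ ⟨l', u', hl', hu', h'⟩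
    have hmono := (Unwound.map_strictMono f).monotone
    refine ⟨max l l', min u u', ?_, ?_, fun y h1 h2 => ⟨?_, ?_⟩⟩
    · rw [hmono.map_max]
      exact max_lt hl hl'
    · rw [hmono.map_min]
      exact lt_min hu hu'
    · exact h y ((le_max_left _ _).trans_lt h1) (h2.trans_le (min_le_left _ _))
    · exact h' y ((le_max_right _ _).trans_lt h1) (h2.trans_le (min_le_right _ _))

variable {f} {x : Unwound M}

theorem eventually_cutFilter {p : Unwound H → Prop} : (∀ᶠ y in cutFilter f x, p y) ↔
    ∃ l u, Unwound.map f l < x ∧ x < Unwound.map f u ∧ ∀ y, l < y → y < u → p y := Iff.rfl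

theorem eventually_gt_cutFilter {s : Unwound H} (h : Unwound.map f s < x) :
    ∀ᶠ y in cutFilter f x, s < y := by
  obtain ⟨l, u, hl, hu, -⟩ := eventually_cutFilter.1 (Filter.univ_mem (f := cutFilter f x))
  exact eventually_cutFilter.2 ⟨s, u, h, hu, fun y h1 _ => h1⟩

theorem eventually_lt_cutFilter {s : Unwound H} (h : x < Unwound.map f s) :
    ∀ᶠ y in cutFilter f x, y < s := by
  obtain ⟨l, u, hl, hu, -⟩ := eventually_cutFilter.1 (Filter.univ_mem (f := cutFilter f x))
  exact eventually_cutFilter.2 ⟨l, s, hl, h, fun y _ h1 => h1⟩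

end Cut

variable [H ⊨ TcD] [M ⊨ abelianCog] {f : H ↪[cog] M} {x : Unwound M}

/-- Density: a divisible ordered group contains the midpoint of any two of its elements. -/
theorem cutFilter_neBot : (cutFilter f x).NeBot := by
  refine Filter.neBot_iff.2 fun hbot => ?_
  obtain ⟨l, u, hl, hu, h⟩ := eventually_cutFilter.1
    (Filter.eventually_false_iff_eq_bot.2 hbot)
  have hlu := (Unwound.map_strictMono f).lt_iff_lt.1 (hl.trans hu)
  obtain ⟨y, hy⟩ := Unwound.divisible 2 two_ne_zero (l + u)
  rw [two_smul] at hy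
  refine h y (not_le.1 fun hc => ?_) (not_le.1 fun hc => ?_)
  · exact (add_le_add hc hc).not_gt (hy ▸ add_lt_add_right hlu l)
  · exact (add_le_add hc hc).not_gt (hy ▸ add_lt_add_left hlu u)

/-- For `k ≠ 0`, dividing `h` by `|k|` turns the inequality into a strict comparison of the variable
with a point of the unwound of `H`, which may serve as an endpoint of the interval. -/
theorem eventually_pos (h : Unwound H) (k : ℤ)
    (hpos : 0 < Unwound.map f h + k • x) :
    ∀ᶠ y in cutFilter f x, 0 < Unwound.map f h + k • Unwound.map f y := by
  rcases lt_trichotomy k 0 with hk | rfl | hk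
  · obtain ⟨n, rfl⟩ : ∃ n : ℕ, k = -n := ⟨k.natAbs, by omega⟩
    have hn : n ≠ 0 := by rintro rfl; simp at hk
    obtain ⟨s, hs⟩ := Unwound.divisible n hn h
    have e : ∀ t : Unwound M, 0 < Unwound.map f h + (-n : ℤ) • t ↔ t < Unwound.map f s := by
      intro t
      rw [← hs, map_nsmul, neg_smul, natCast_zsmul, ← sub_eq_add_neg, sub_pos,
        (nsmul_right_strictMono hn).lt_iff_lt]
    simp only [e] at hpos ⊢
    filter_upwards [eventually_lt_cutFilter hpos] with y hy
    exact Unwound.map_strictMono f hy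
  · exact Filter.Eventually.of_forall fun y => by simpa using hpos
  · obtain ⟨n, rfl⟩ : ∃ n : ℕ, k = n := ⟨k.natAbs, by omega⟩
    have hn : n ≠ 0 := by rintro rfl; simp at hk
    obtain ⟨s, hs⟩ := Unwound.divisible n hn (-h)
    have e : ∀ t : Unwound M, 0 < Unwound.map f h + (n : ℤ) • t ↔ Unwound.map f s < t := by
      intro t
      rw [← neg_neg h, ← hs, map_neg, map_nsmul, natCast_zsmul, neg_add_eq_sub, sub_pos,
        (nsmul_right_strictMono hn).lt_iff_lt]
    simp only [e] at hpos ⊢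
    filter_upwards [eventually_gt_cutFilter hpos] with y hy
    exact Unwound.map_strictMono f hy

variable (f) in
/-- A map `y ↦ h + ky` with coefficients in the unwound of `H`. -/
def IsLinear (l : Unwound M → Unwound M) : Prop :=
  ∃ (h : Unwound H) (k : ℤ), ∀ y, l y = Unwound.map f h + k • y

theorem IsLinear.sub {l l' : Unwound M → Unwound M} (hl : IsLinear f l) (hl' : IsLinear f l') :
    IsLinear f fun y => l y - l' y := by
  obtain ⟨h, k, e⟩ := hl
  obtain ⟨h', k', e'⟩ := hl'
  exact ⟨h - h', k - k', fun y => by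
    change l y - l' y = _
    rw [e, e', map_sub, sub_smul]
    abel⟩

theorem IsLinear.add {l l' : Unwound M → Unwound M} (hl : IsLinear f l) (hl' : IsLinear f l') :
    IsLinear f fun y => l y + l' y := by
  obtain ⟨h, k, e⟩ := hl
  obtain ⟨h', k', e'⟩ := hl'
  exact ⟨h + h', k + k', fun y => by
    change l y + l' y = _
    rw [e, e', map_add, add_smul]
    abel⟩

theorem isLinear_map (h : Unwound H) : IsLinear f fun _ => Unwound.map f h :=
  ⟨h, 0, fun y => by rw [zero_smul, add_zero]⟩

theorem isLinear_turn (n : ℤ) : IsLinear f fun _ => n • Unwound.turn :=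
  ⟨n • Unwound.turn, 0, fun y => by rw [map_zsmul, Unwound.map_turn, zero_smul, add_zero]⟩

theorem isLinear_id : IsLinear f fun y => y :=
  ⟨0, 1, fun y => by rw [map_zero, one_smul, zero_add]⟩

theorem IsLinear.add_turn {l : Unwound M → Unwound M} (hl : IsLinear f l) (n : ℤ) :
    IsLinear f fun y => l y + n • Unwound.turn :=
  hl.add (isLinear_turn n)

theorem IsLinear.eventually_lt {l l' : Unwound M → Unwound M} (hl : IsLinear f l)
    (hl' : IsLinear f l') (h : l x < l' x) :
    ∀ᶠ y in cutFilter f x, l (Unwound.map f y) < l' (Unwound.map f y) := by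
  obtain ⟨a, k, e⟩ := hl'.sub hl
  dsimp only at e
  have := eventually_pos a k (by rw [← e]; exact sub_pos.2 h)
  filter_upwards [this] with y hy
  rw [← e] at hy
  exact sub_pos.1 hy

/-- An equation with nonzero coefficient would give `x` as a quotient of an element of the divisible
unwound of `H`. For `x` outside it, the coefficient is zero and the two maps agree everywhere. -/
theorem IsLinear.eventually_eq {l l' : Unwound M → Unwound M} (hl : IsLinear f l)
    (hl' : IsLinear f l') (hx : x ∉ Set.range (Unwound.map f)) (h : l x = l' x) :
    ∀ᶠ y in cutFilter f x, l (Unwound.map f y) = l' (Unwound.map f y) := by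
  obtain ⟨a, k, e⟩ := hl'.sub hl
  dsimp only at e
  have h0 : Unwound.map f a + k • x = 0 := by rw [← e, h, sub_self]
  have hk : k = 0 := by
    by_contra hk
    obtain ⟨s, hs⟩ := Unwound.divisible k.natAbs (Int.natAbs_ne_zero.2 hk) a
    have h1 : k.natAbs • (Unwound.map f s) = -(k • x) := by
      rw [← map_nsmul, hs]
      exact eq_neg_of_add_eq_zero_left h0
    rcases Int.natAbs_eq k with hk' | hk'
    · rw [hk', natCast_zsmul, Int.natAbs_natCast, ← smul_neg] at h1
      refine hx ⟨-s, ?_⟩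
      rw [map_neg, nsmul_right_injective (Int.natAbs_ne_zero.2 hk) h1, neg_neg]
    · rw [hk', neg_smul, natCast_zsmul, Int.natAbs_neg, Int.natAbs_natCast, neg_neg] at h1
      exact hx ⟨s, nsmul_right_injective (Int.natAbs_ne_zero.2 hk) h1⟩
  subst hk
  refine Filter.Eventually.of_forall fun y => ?_
  rw [zero_smul, add_zero] at h0
  have := e (Unwound.map f y)
  rw [h0, zero_smul, add_zero] at this
  exact (sub_eq_zero.1 this).symm

theorem IsLinear.eventually_proj_eq {l l' : Unwound M → Unwound M} (hl : IsLinear f l)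
    (hl' : IsLinear f l') (hx : x ∉ Set.range (Unwound.map f))
    (h : (l x).proj = (l' x).proj) :
    ∀ᶠ y in cutFilter f x, (l (Unwound.map f y)).proj = (l' (Unwound.map f y)).proj := by
  obtain ⟨n, hn⟩ := Unwound.isUnwinding.map_eq.1 h
  filter_upwards [hl.eventually_eq (hl'.add_turn n) hx hn] with y hy
  exact Unwound.isUnwinding.map_eq.2 ⟨n, hy⟩

/-- Being distinct modulo `turn` means lying strictly between consecutive translates, a condition
made of strict inequalities, which persist. -/
theorem IsLinear.eventually_proj_ne {l l' : Unwound M → Unwound M} (hl : IsLinear f l)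
    (hl' : IsLinear f l')
    (h : (l x).proj ≠ (l' x).proj) :
    ∀ᶠ y in cutFilter f x, (l (Unwound.map f y)).proj ≠ (l' (Unwound.map f y)).proj := by
  obtain ⟨n, h1, h2⟩ := Unwound.isUnwinding.exists_mem_Ico (l x) (l' x)
  have h1 := lt_of_le_of_ne h1 fun hn => h (Unwound.isUnwinding.map_eq.2 ⟨n, hn⟩)
  replace h2 : l' x + n • Unwound.turn < l x + (1 : ℤ) • Unwound.turn := by rwa [one_smul]
  filter_upwards [hl.eventually_lt (hl'.add_turn n) h1,
    (hl'.add_turn n).eventually_lt (hl.add_turn 1) h2] with y h1 h2 he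
  rw [one_smul] at h2
  refine Unwound.isUnwinding.not_lt_of_eq (he.trans ?_) h1 h2
  exact (Unwound.isUnwinding.map_add_zsmul _ n).symm

theorem IsLinear.eventually_rel {a b c : Unwound M → Unwound M} (ha : IsLinear f a)
    (hb : IsLinear f b) (hc : IsLinear f c)
    (h : Rel (a x).proj (b x).proj (c x).proj) :
    ∀ᶠ y in cutFilter f x, Rel (a (Unwound.map f y)).proj (b (Unwound.map f y)).proj
      (c (Unwound.map f y)).proj := by
  obtain ⟨m, n, h1, h2, h3⟩ := Unwound.isUnwinding.rel.1 h
  replace h3 : c x + n • Unwound.turn < a x + (1 : ℤ) • Unwound.turn := by rwa [one_smul]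
  filter_upwards [ha.eventually_lt (hb.add_turn m) h1,
    (hb.add_turn m).eventually_lt (hc.add_turn n) h2,
    (hc.add_turn n).eventually_lt (ha.add_turn 1) h3] with y h1 h2 h3
  rw [one_smul] at h3
  exact Unwound.isUnwinding.rel.2 ⟨m, n, h1, h2, h3⟩

/-- If `R` fails, either two of the points coincide or the opposite orientation holds; each of these
persists. -/
theorem IsLinear.eventually_not_rel {a b c : Unwound M → Unwound M} (ha : IsLinear f a)
    (hb : IsLinear f b) (hc : IsLinear f c) (hx : x ∉ Set.range (Unwound.map f))
    (h : ¬Rel (a x).proj (b x).proj (c x).proj) :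
    ∀ᶠ y in cutFilter f x, ¬Rel (a (Unwound.map f y)).proj (b (Unwound.map f y)).proj
      (c (Unwound.map f y)).proj := by
  by_cases hab : (a x).proj = (b x).proj
  · filter_upwards [ha.eventually_proj_eq hb hx hab] with y hy hr
    exact hr.ne.1 hy
  by_cases hac : (a x).proj = (c x).proj
  · filter_upwards [ha.eventually_proj_eq hc hx hac] with y hy hr
    exact hr.ne.2.2 hy.symm
  by_cases hbc : (b x).proj = (c x).proj
  · filter_upwards [hb.eventually_proj_eq hc hx hbc] with y hy hr
    exact hr.ne.2.1 hy
  filter_upwards [ha.eventually_rel hc hb ((Rel.total hab hac hbc).resolve_left h)] with y hy hr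
  exact hr.asymm hy

variable (f) in
/-- A map to `M` that lifts to a linear map to the unwound of `M`. -/
def IsForm (l : Unwound M → M) : Prop := ∃ l', IsLinear f l' ∧ ∀ y, l y = (l' y).proj

theorem isForm_realize {β : Type*} (t : cog.Term β) (V : β → Unwound M → M)
    (hV : ∀ b, IsForm f (V b)) : IsForm f fun y => t.realize fun b => V b y := by
  induction t with
  | var b => exact hV b
  | @func l F ts ih =>
    match l, F, ts, ih with
    | _, .one, ts, ih => exact ⟨fun _ => 0, by simpa using isLinear_map (f := f) 0, fun y =>
        (funMap_one _).trans (map_zero Unwound.proj).symm⟩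
    | _, .inv, ts, ih =>
      obtain ⟨l, hl, e⟩ := ih 0
      refine ⟨fun y => 0 - l y, IsLinear.sub (by simpa using isLinear_map (f := f) 0) hl,
        fun y => (funMap_inv _).trans ?_⟩
      change -_ = Unwound.proj (0 - l y)
      rw [zero_sub, map_neg, ← e]
    | _, .mul, ts, ih =>
      obtain ⟨l, hl, e⟩ := ih 0
      obtain ⟨l', hl', e'⟩ := ih 1
      refine ⟨fun y => l y + l' y, hl.add hl', fun y => (funMap_mul _).trans ?_⟩
      rw [map_add, ← e, ← e']

theorem eventually_realize_iff {α : Type*} {n : ℕ} {ψ : cog.BoundedFormula α n} (hψ : ψ.IsQF)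
    (V : α → Unwound M → M) (hV : ∀ a, IsForm f (V a)) (X : Fin n → Unwound M → M)
    (hX : ∀ i, IsForm f (X i)) (hx : x ∉ Set.range (Unwound.map f)) :
    ∀ᶠ y in cutFilter f x,
      (ψ.Realize (fun a => V a (Unwound.map f y)) (fun i => X i (Unwound.map f y)) ↔
        ψ.Realize (fun a => V a x) fun i => X i x) := by
  have hterm : ∀ t : cog.Term (α ⊕ Fin n), ∃ l, IsLinear f l ∧
      ∀ y, t.realize (Sum.elim (fun a => V a y) fun i => X i y) = (l y).proj := fun t => by
    obtain ⟨l, hl, e⟩ := isForm_realize (f := f) t (Sum.elim V X) (Sum.rec hV hX)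
    refine ⟨l, hl, fun y => (congrArg t.realize ?_).trans (e y)⟩
    funext b
    cases b <;> rfl
  induction hψ with
  | falsum => exact Filter.Eventually.of_forall fun _ => Iff.rfl
  | of_isAtomic h =>
    cases h with
    | equal t s =>
      obtain ⟨l, hl, e⟩ := hterm t
      obtain ⟨l', hl', e'⟩ := hterm s
      simp only [BoundedFormula.realize_bdEqual, e, e']
      by_cases h : (l x).proj = (l' x).proj
      · filter_upwards [hl.eventually_proj_eq hl' hx h] with y hy
        exact iff_of_true hy h
      · filter_upwards [hl.eventually_proj_ne hl' h] with y hy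
        exact iff_of_false hy h
    | @rel l r ts =>
      match l, r, ts with
      | _, .R, ts =>
        obtain ⟨a, ha, ea⟩ := hterm (ts 0)
        obtain ⟨b, hb, eb⟩ := hterm (ts 1)
        obtain ⟨c, hc, ec⟩ := hterm (ts 2)
        have e : ∀ y, (relF.boundedFormula ts).Realize (fun a => V a y) (fun i => X i y) ↔
            Rel (a y).proj (b y).proj (c y).proj := fun y => by
          rw [BoundedFormula.realize_rel, relMap_rel, ea, eb, ec]
        by_cases h : Rel (a x).proj (b x).proj (c x).proj
        · filter_upwards [ha.eventually_rel hb hc h] with y hy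
          exact iff_of_true ((e _).2 hy) ((e _).2 h)
        · filter_upwards [ha.eventually_not_rel hb hc hx h] with y hy
          exact iff_of_false (fun h => hy ((e _).1 h)) (fun h' => h ((e _).1 h'))
  | imp _ _ ih₁ ih₂ =>
    filter_upwards [ih₁, ih₂] with y h₁ h₂
    rw [BoundedFormula.realize_imp, BoundedFormula.realize_imp, h₁, h₂]

/-- A c-divisible group is existentially closed in its extensions, for formulas with one
quantifier. -/
theorem exists_realize_of_embedding {α : Type*} {n : ℕ} {ψ : cog.BoundedFormula α (n + 1)}
    (hψ : ψ.IsQF) (f : H ↪[cog] M) (v : α → H) (xs : Fin n → H) (x : M)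
    (h : ψ.Realize (f ∘ v) (Fin.snoc (f ∘ xs) x : Fin (n + 1) → M)) :
    ∃ a : H, ψ.Realize v (Fin.snoc xs a : Fin (n + 1) → H) := by
  -- If the lift of `x` comes from `H`, then so does `x`. Otherwise the truth of `ψ` at `x` spreads
  -- to the cut filter, which is proper and hence contains a point of the unwound of `H`.
  by_cases hx : (⟨0, x⟩ : Unwound M) ∈ Set.range (Unwound.map f)
  · obtain ⟨y, hy⟩ := hx
    have hy : f y.pt = x := congrArg Unwound.pt hy
    refine ⟨y.pt, (hψ.realize_embedding f).1 ?_⟩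
    rwa [Fin.comp_snoc, hy]
  · have hform : ∀ a : H, IsForm f fun _ => f a := fun a =>
      ⟨fun _ => Unwound.map f ⟨0, a⟩, isLinear_map _, fun _ => rfl⟩
    have := eventually_realize_iff hψ (fun a _ => f (v a)) (fun a => hform _)
      (Fin.snoc (fun i _ => f (xs i)) fun y => y.proj : Fin (n + 1) → Unwound M → M)
      (fun i => by
        refine Fin.lastCases ?_ (fun i => ?_) i
        · rw [Fin.snoc_last]
          exact ⟨fun y => y, isLinear_id, fun _ => rfl⟩
        · rw [Fin.snoc_castSucc]
          exact hform _) hx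
    have hne := cutFilter_neBot (f := f) (x := (⟨0, x⟩ : Unwound M))
    obtain ⟨y, hy⟩ := this.exists
    have e : ∀ y : Unwound M, (fun i => (Fin.snoc (fun i _ => f (xs i)) fun y => y.proj :
        Fin (n + 1) → Unwound M → M) i y) = Fin.snoc (f ∘ xs) y.proj := fun y => by
      funext i
      refine Fin.lastCases ?_ (fun i => ?_) i
      · simp only [Fin.snoc_last]
      · simp only [Fin.snoc_castSucc, Function.comp]
    refine ⟨y.pt, (hψ.realize_embedding f).1 ?_⟩
    rw [Fin.comp_snoc]
    rw [e, e] at hy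
    exact hy.2 h

end ExistentiallyClosed

/-! ### Compactness, quantifier elimination criteria and diagrams -/

section ModelTheoryTools

variable {L : FirstOrder.Language.{0, 0}}

/-- Compactness for a set of formulas, in models of a theory. -/
theorem exists_realize_of_finite (T : L.Theory) {γ : Type u} (Δ : Set (L.Formula γ))
    (h : ∀ Δ₀ : Finset (L.Formula γ), ↑Δ₀ ⊆ Δ → ∃ (M : Type w) (_ : L.Structure M) (_ : M ⊨ T)
      (_ : Nonempty M) (v : γ → M), ∀ ψ ∈ Δ₀, ψ.Realize v) :
    ∃ (M : Type u) (_ : L.Structure M) (_ : M ⊨ T) (_ : Nonempty M) (v : γ → M),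
      ∀ ψ ∈ Δ, ψ.Realize v := by
  classical
  have hsat : ((L.lhomWithConstants γ).onTheory T ∪ Formula.equivSentence '' Δ).IsSatisfiable := by
    refine Theory.isSatisfiable_iff_isFinitelySatisfiable.2 fun T₀ hT₀ => ?_
    obtain ⟨M, _, _, _, v, hv⟩ := h
      ((T₀.image Formula.equivSentence.symm).filter (· ∈ Δ)) (fun x hx => (Finset.mem_filter.1 hx).2)
    let _ : (constantsOn γ).Structure M := constantsOn.structure v
    have hM : M ⊨ (T₀ : L[[γ]].Theory) := (Theory.model_iff _).2 fun φ hφ => by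
      rcases hT₀ hφ with hφT | ⟨ψ, hψ, rfl⟩
      · have : M ⊨ (L.lhomWithConstants γ).onTheory T := (LHom.onTheory_model _ _).2 inferInstance
        exact Theory.realize_sentence_of_mem _ hφT
      · refine (Formula.realize_equivSentence M ψ).2 (hv ψ ?_)
        simp only [Finset.mem_filter, Finset.mem_image]
        exact ⟨⟨_, hφ, Equiv.symm_apply_apply _ _⟩, hψ⟩
    exact Theory.Model.isSatisfiable M
  obtain ⟨M⟩ := hsat
  let _ := (L.lhomWithConstants γ).reduct M
  have hM := M.is_model
  rw [Theory.model_union_iff] at hM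
  refine ⟨M, inferInstance, (LHom.onTheory_model (L.lhomWithConstants γ) T).1 hM.1, inferInstance,
    fun a => (L.con a : M), fun ψ hψ => ?_⟩
  exact (Formula.realize_equivSentence M ψ).1 ((Theory.model_iff _).1 hM.2 _ ⟨ψ, hψ, rfl⟩)

variable {α : Type} {n : ℕ}

theorem exists_realize_bounded_of_finite (T : L.Theory) (Δ : Set (L.BoundedFormula α n))
    (h : ∀ Δ₀ : Finset (L.BoundedFormula α n), ↑Δ₀ ⊆ Δ → ∃ (M : Type) (_ : L.Structure M)
      (_ : M ⊨ T) (_ : Nonempty M) (v : α → M) (xs : Fin n → M), ∀ ψ ∈ Δ₀, ψ.Realize v xs) :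
    ∃ (M : Type) (_ : L.Structure M) (_ : M ⊨ T) (_ : Nonempty M) (v : α → M) (xs : Fin n → M),
      ∀ ψ ∈ Δ, ψ.Realize v xs := by
  classical
  obtain ⟨M, i₁, i₂, i₃, v, hv⟩ := exists_realize_of_finite.{0, 0} T
      (BoundedFormula.toFormula '' Δ) fun Δ₀ hΔ₀ => by
    obtain ⟨Δ₁, hΔ₁, rfl⟩ := Finset.subset_set_image_iff.1 hΔ₀
    obtain ⟨M, i₁, i₂, i₃, v, xs, hv⟩ := h Δ₁ hΔ₁
    refine ⟨M, i₁, i₂, i₃, Sum.elim v xs, fun ψ hψ => ?_⟩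
    obtain ⟨φ, hφ, rfl⟩ := Finset.mem_image.1 hψ
    exact (BoundedFormula.realize_toFormula φ _).2 (hv φ hφ)
  exact ⟨M, i₁, i₂, i₃, v ∘ Sum.inl, v ∘ Sum.inr, fun ψ hψ =>
    (BoundedFormula.realize_toFormula ψ v).1 (hv _ ⟨ψ, hψ, rfl⟩)⟩

theorem exists_isQF_conjunction (Δ : Finset (L.BoundedFormula α n)) (hΔ : ∀ ψ ∈ Δ, ψ.IsQF) :
    ∃ θ : L.BoundedFormula α n, θ.IsQF ∧ ∀ (M : Type) [L.Structure M] (v : α → M)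
      (xs : Fin n → M), θ.Realize v xs ↔ ∀ ψ ∈ Δ, ψ.Realize v xs := by
  classical
  induction Δ using Finset.induction with
  | empty => exact ⟨⊤, BoundedFormula.IsQF.top, by simp⟩
  | insert ψ Δ _ ih =>
    obtain ⟨θ, hθ, h⟩ := ih fun ψ hψ => hΔ ψ (Finset.mem_insert_of_mem hψ)
    refine ⟨ψ ⊓ θ, (hΔ ψ (Finset.mem_insert_self _ _)).inf hθ, fun M _ v xs => ?_⟩
    rw [BoundedFormula.realize_inf, h, Finset.forall_mem_insert]

/-- A formula whose truth is determined by the quantifier-free type of its arguments is equivalent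
to a quantifier-free formula. -/
theorem exists_isQF_iff (T : L.Theory) (φ : L.BoundedFormula α n)
    (h : ∀ (M N : Type) [L.Structure M] [L.Structure N] [M ⊨ T] [N ⊨ T] (v : α → M)
      (xs : Fin n → M) (w : α → N) (ys : Fin n → N),
      (∀ ψ : L.BoundedFormula α n, ψ.IsQF → ψ.Realize v xs → ψ.Realize w ys) →
      φ.Realize v xs → φ.Realize w ys) :
    ∃ θ : L.BoundedFormula α n, θ.IsQF ∧ (φ ⇔[T] θ) := by
  classical
  let Cons : Set (L.BoundedFormula α n) := {θ | θ.IsQF ∧ ∀ (M : Type) [L.Structure M] [M ⊨ T]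
    [Nonempty M] (v : α → M) (xs : Fin n → M), φ.Realize v xs → θ.Realize v xs}
  by_contra hno
  -- A tuple satisfying all quantifier-free consequences of `φ` but not `φ`. If there were none, a
  -- finite conjunction of these consequences would imply `φ`, hence be equivalent to it.
  obtain ⟨N, _, _, _, w, ys, hN⟩ := exists_realize_bounded_of_finite T (Cons ∪ {∼φ})
      fun Δ₀ hΔ₀ => by
    by_contra hcon
    have hsub : ∀ ψ ∈ Δ₀.erase (∼φ), ψ ∈ Cons := fun ψ hψ =>
      (hΔ₀ (Finset.mem_of_mem_erase hψ)).resolve_right (Finset.ne_of_mem_erase hψ)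
    obtain ⟨θ, hθ, hθ'⟩ := exists_isQF_conjunction (Δ₀.erase (∼φ)) fun ψ hψ => (hsub ψ hψ).1
    refine hno ⟨θ, hθ, fun M v xs => ?_⟩
    rw [BoundedFormula.realize_iff]
    refine ⟨fun hφ => (hθ' M v xs).2 fun ψ hψ => (hsub ψ hψ).2 M v xs hφ, fun hr => ?_⟩
    by_contra hφ
    refine hcon ⟨M, inferInstance, inferInstance, inferInstance, v, xs, fun ψ hψ => ?_⟩
    by_cases he : ψ = ∼φ
    · rw [he, BoundedFormula.realize_not]
      exact hφ
    · exact (hθ' M v xs).1 hr ψ (Finset.mem_erase.2 ⟨he, hψ⟩)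
  -- A tuple satisfying `φ` with the quantifier-free type of `w, ys`. Otherwise `φ` would refute a
  -- finite part of that type, and the negation of that part, being a consequence of `φ`, would hold
  -- at `w, ys`.
  obtain ⟨M, _, _, _, v, xs, hM⟩ := exists_realize_bounded_of_finite T
      ({ψ | ψ.IsQF ∧ ψ.Realize w ys} ∪ {φ}) fun Δ₀ hΔ₀ => by
    by_contra hcon
    have hsub : ∀ ψ ∈ Δ₀.erase φ, ψ.IsQF ∧ ψ.Realize w ys := fun ψ hψ =>
      (hΔ₀ (Finset.mem_of_mem_erase hψ)).resolve_right (Finset.ne_of_mem_erase hψ)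
    obtain ⟨θ, hθ, hθ'⟩ := exists_isQF_conjunction (Δ₀.erase φ) fun ψ hψ => (hsub ψ hψ).1
    refine BoundedFormula.realize_not.1 (hN (∼θ) (.inl ⟨hθ.not, fun M _ _ _ v xs hφ => ?_⟩))
      ((hθ' N w ys).2 fun ψ hψ => (hsub ψ hψ).2)
    rw [BoundedFormula.realize_not]
    refine fun hr => hcon ⟨M, inferInstance, inferInstance, inferInstance, v, xs, fun ψ hψ => ?_⟩
    by_cases he : ψ = φ
    · rwa [he]
    · exact (hθ' M v xs).1 hr ψ (Finset.mem_erase.2 ⟨he, hψ⟩)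
  refine BoundedFormula.realize_not.1 (hN _ (.inr rfl)) (h M N v xs w ys (fun ψ hψ hr => ?_)
    (hM φ (.inr rfl)))
  by_contra hc
  exact BoundedFormula.realize_not.1
    (hM (∼ψ) (.inl ⟨hψ.not, BoundedFormula.realize_not.2 hc⟩)) hr

/-- Quantifier elimination, from the elimination of one existential quantifier. -/
theorem exists_isQF_iff_of_ex {T : L.Theory}
    (h : ∀ {m : ℕ} {ψ : L.BoundedFormula α (m + 1)}, ψ.IsQF →
      ∃ θ : L.BoundedFormula α m, θ.IsQF ∧ (ψ.ex ⇔[T] θ))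
    (φ : L.BoundedFormula α n) : ∃ θ : L.BoundedFormula α n, θ.IsQF ∧ (φ ⇔[T] θ) := by
  refine BoundedFormula.induction_on_exists_not
    (P := fun {m} φ => ∃ θ : L.BoundedFormula α m, θ.IsQF ∧ (φ ⇔[T] θ)) φ
    (fun {_ ψ} hψ => ⟨ψ, hψ, Theory.Iff.refl ψ⟩)
    (fun ⟨θ, hθ, e⟩ => ⟨∼θ, hθ.not, e.not⟩)
    (fun ⟨θ, hθ, e⟩ => ?_) (fun {_ φ₁ φ₂} e => ?_)
  · obtain ⟨θ', hθ', e'⟩ := h hθ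
    exact ⟨θ', hθ', e.ex.trans e'⟩
  · have e : φ₁ ⇔[T] φ₂ := fun M v xs => (BoundedFormula.realize_iff).2
      (e.realize_bd_iff (M := M))
    exact ⟨fun ⟨θ, hθ, e'⟩ => ⟨θ, hθ, e.symm.trans e'⟩, fun ⟨θ, hθ, e'⟩ => ⟨θ, hθ, e.trans e'⟩⟩

/-- The values of terms at a given assignment form a substructure, which embeds in any structure
with an assignment that satisfies the same atomic formulas. -/
theorem exists_substructure_embedding {M N : Type} [L.Structure M] [L.Structure N] (v : α → M)
    (xs : Fin n → M) (w : α → N) (ys : Fin n → N)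
    (h : ∀ ψ : L.BoundedFormula α n, ψ.IsQF → ψ.Realize v xs → ψ.Realize w ys) :
    ∃ (A : L.Substructure M) (f : A ↪[L] N) (v' : α → A) (xs' : Fin n → A),
      A.subtype ∘ v' = v ∧ A.subtype ∘ xs' = xs ∧ f ∘ v' = w ∧ f ∘ xs' = ys := by
  have hiff : ∀ ψ : L.BoundedFormula α n, ψ.IsQF → (ψ.Realize v xs ↔ ψ.Realize w ys) :=
    fun ψ hψ => ⟨h ψ hψ, fun hr => by
      by_contra hc
      exact BoundedFormula.realize_not.1 (h _ hψ.not (BoundedFormula.realize_not.2 hc)) hr⟩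
  have heq : ∀ t s : L.Term (α ⊕ Fin n), t.realize (Sum.elim v xs) = s.realize (Sum.elim v xs) ↔
      t.realize (Sum.elim w ys) = s.realize (Sum.elim w ys) := fun t s => by
    simpa using hiff _ (BoundedFormula.IsAtomic.equal t s).isQF
  let A : L.Substructure M :=
    { carrier := Set.range fun t : L.Term (α ⊕ Fin n) => t.realize (Sum.elim v xs)
      fun_mem := fun F x hx => by
        choose t ht using hx
        exact ⟨Term.func F t, congrArg (Structure.funMap F) (funext ht)⟩ }
  choose t ht using fun a : A => a.2
  let F : A → N := fun a => (t a).realize (Sum.elim w ys)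
  have hF : ∀ (s : L.Term (α ⊕ Fin n)) (a : A), s.realize (Sum.elim v xs) = a →
      F a = s.realize (Sum.elim w ys) := fun s a ha => (heq _ _).1 ((ht a).trans ha.symm)
  refine ⟨A, ⟨⟨F, fun a b hab => Subtype.ext ?_⟩, fun {_} G a => ?_, fun {_} r a => ?_⟩,
    fun i => ⟨v i, Term.var (.inl i), rfl⟩, fun i => ⟨xs i, Term.var (.inr i), rfl⟩, rfl, rfl, ?_, ?_⟩
  · have := (heq _ _).2 hab
    exact (ht a).symm.trans (this.trans (ht b))
  · exact hF (Term.func G fun i => t (a i)) _ (congrArg (Structure.funMap G)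
      (funext fun i => ht (a i)))
  · have := hiff (r.boundedFormula fun i => t (a i)) (BoundedFormula.IsAtomic.rel _ _).isQF
    rw [BoundedFormula.realize_rel, BoundedFormula.realize_rel] at this
    refine Iff.trans this.symm (iff_of_eq (congrArg (Structure.RelMap r) ?_))
    exact funext fun i => ht (a i)
  · exact funext fun i => hF (Term.var (.inl i)) _ rfl
  · exact funext fun i => hF (Term.var (.inr i)) _ rfl

/-- The parameters of `θ` outside `f(M)` are quantified existentially. The resulting formula over
`M` holds in `N`, so in `M` and in `P`, where it yields new values for those parameters. -/
theorem exists_realize_of_elementary {M N P : Type u} [L.Structure M] [L.Structure N]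
    [L.Structure P] [Nonempty P] (f : M ↪ₑ[L] N) (g : M ↪ₑ[L] P) (θ : L.Formula N)
    (hθ : θ.Realize id) : ∃ y : N → P, θ.Realize y ∧ ∀ m, y (f m) = g m := by
  classical
  let ρ : θ.freeVarFinset → M ⊕ θ.freeVarFinset := fun b =>
    if hb : ∃ m, f m = b then .inl hb.choose else .inr b
  let χ : L.Formula M := Formula.iExs θ.freeVarFinset
    (Formula.relabel ρ (BoundedFormula.restrictFreeVar θ id))
  have hχ : χ.Realize (f ∘ id) := by
    refine Formula.realize_iExs.2 ⟨fun b => b, Formula.realize_relabel.2 ?_⟩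
    refine (BoundedFormula.realize_restrictFreeVar (v' := id) fun b => ?_).2 hθ
    by_cases hb : ∃ m, f m = b
    · have e : ρ b = .inl hb.choose := dif_pos hb
      change Sum.elim _ _ (ρ b) = (b : N)
      rw [e]
      exact hb.choose_spec
    · have e : ρ b = .inr b := dif_neg hb
      change Sum.elim _ _ (ρ b) = (b : N)
      rw [e]
      rfl
  obtain ⟨i, hi⟩ := Formula.realize_iExs.1
    ((g.map_formula χ id).2 ((f.map_formula χ id).1 hχ))
  let y : N → P := fun b => if hb : ∃ m, f m = b then g hb.choose else
    if hb : b ∈ θ.freeVarFinset then i ⟨b, hb⟩ else Classical.arbitrary P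
  refine ⟨y, ?_, fun m => ?_⟩
  · refine (BoundedFormula.realize_restrictFreeVar (f := id) y fun b => ?_).1
      (Formula.realize_relabel.1 hi)
    by_cases hb : ∃ m, f m = b
    · have e : ρ b = .inl hb.choose := dif_pos hb
      change Sum.elim _ _ (ρ b) = y b
      have e' : y b = g hb.choose := dif_pos hb
      rw [e, e']
      rfl
    · have e : ρ b = .inr b := dif_neg hb
      change Sum.elim _ _ (ρ b) = y b
      rw [e]
      have e' : y b = i ⟨b, b.2⟩ := (dif_neg hb).trans (dif_pos b.2)
      exact e'.symm
  · have hb : ∃ m', f m' = f m := ⟨m, rfl⟩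
    simp only [y, dif_pos hb]
    rw [f.injective hb.choose_spec]

/-- Two elementary extensions of a model of `T` have a common elementary extension. -/
theorem exists_elementary_amalgam {T : L.Theory} {M N P : Type u} [L.Structure M] [L.Structure N]
    [L.Structure P] [Nonempty P] [hP : P ⊨ T] (f : M ↪ₑ[L] N) (g : M ↪ₑ[L] P) :
    ∃ (Q : Type u) (_ : L.Structure Q) (_ : Q ⊨ T) (f' : N ↪ₑ[L] Q) (g' : P ↪ₑ[L] Q),
      ∀ m, f' (f m) = g' (g m) := by
  classical
  -- The elementary diagrams of `N` and of `P`, with the two copies of `M` identified. Any finite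
  -- part is satisfied in `P` itself, by reinterpreting the elements of `N`.
  let Δ : Set (L.Formula (N ⊕ P)) := {ψ | ∃ φ : L.Formula N, φ.Realize id ∧ ψ = φ.relabel .inl} ∪
    {ψ | ∃ φ : L.Formula P, φ.Realize id ∧ ψ = φ.relabel .inr} ∪
    {ψ | ∃ m, ψ = Term.equal (Term.var (.inl (f m))) (Term.var (.inr (g m)))}
  have hfin : ∀ Δ₀ : Finset (L.Formula (N ⊕ P)), ↑Δ₀ ⊆ Δ → ∃ θ : L.Formula N, θ.Realize id ∧
      ∀ y : N → P, θ.Realize y → (∀ m, y (f m) = g m) → ∀ ψ ∈ Δ₀, ψ.Realize (Sum.elim y id) := by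
    intro Δ₀
    induction Δ₀ using Finset.induction with
    | empty => exact fun _ => ⟨⊤, by simp [Formula.Realize], by simp⟩
    | insert ψ Δ₀ _ ih =>
      intro h
      rw [Finset.coe_insert, Set.insert_subset_iff] at h
      obtain ⟨θ, hθ, hy⟩ := ih h.2
      rcases h.1 with (⟨φ, hφ, rfl⟩ | ⟨φ, hφ, rfl⟩) | ⟨m, rfl⟩
      · refine ⟨φ ⊓ θ, Formula.realize_inf.2 ⟨hφ, hθ⟩, fun y h h' => ?_⟩
        rw [Formula.realize_inf] at h
        rw [Finset.forall_mem_insert]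
        refine ⟨?_, hy y h.2 h'⟩
        rw [Formula.realize_relabel]
        exact h.1
      · refine ⟨θ, hθ, fun y h h' => ?_⟩
        rw [Finset.forall_mem_insert]
        refine ⟨?_, hy y h h'⟩
        rw [Formula.realize_relabel]
        exact hφ
      · refine ⟨θ, hθ, fun y h h' => ?_⟩
        rw [Finset.forall_mem_insert]
        refine ⟨?_, hy y h h'⟩
        rw [Formula.realize_equal]
        exact h' m
  obtain ⟨Q, _, _, _, v, hv⟩ := exists_realize_of_finite.{u, u} T Δ fun Δ₀ hΔ₀ => by
    obtain ⟨θ, hθ, h⟩ := hfin Δ₀ hΔ₀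
    obtain ⟨y, hy, hy'⟩ := exists_realize_of_elementary f g θ hθ
    exact ⟨P, inferInstance, inferInstance, inferInstance, Sum.elim y id, h y hy hy'⟩
  have helem : ∀ {K : Type u} [L.Structure K] (j : K → Q),
      (∀ φ : L.Formula K, φ.Realize id → φ.Realize j) → ∀ (n : ℕ) (φ : L.Formula (Fin n))
        (x : Fin n → K), φ.Realize (j ∘ x) ↔ φ.Realize x := by
    intro K _ j hj n φ x
    have h1 := hj (φ.relabel x)
    have h2 := hj (∼(φ.relabel x))
    rw [Formula.realize_relabel, Formula.realize_relabel] at h1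
    rw [Formula.realize_not, Formula.realize_not, Formula.realize_relabel,
      Formula.realize_relabel] at h2
    exact ⟨fun h => by_contra fun hc => h2 hc h, h1⟩
  refine ⟨Q, inferInstance, inferInstance,
    ⟨v ∘ .inl, fun {n} => helem _ (fun φ hφ => ?_) n⟩,
    ⟨v ∘ .inr, fun {n} => helem _ (fun φ hφ => ?_) n⟩, fun m => ?_⟩
  · exact Formula.realize_relabel.1 (hv _ (.inl (.inl ⟨φ, hφ, rfl⟩)))
  · exact Formula.realize_relabel.1 (hv _ (.inl (.inr ⟨φ, hφ, rfl⟩)))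
  · exact Formula.realize_equal.1 (hv _ (.inr ⟨m, rfl⟩))

theorem isAtomic_equivSentence {γ : Type u} {ψ : L.Formula γ} (h : BoundedFormula.IsAtomic ψ) :
    BoundedFormula.IsAtomic (Formula.equivSentence ψ) := by
  cases h with
  | equal t s => exact BoundedFormula.IsAtomic.equal _ _
  | rel r ts => exact BoundedFormula.IsAtomic.rel _ _

theorem isAtomic_equivSentence_symm {γ : Type u} {φ : L[[γ]].Sentence}
    (h : BoundedFormula.IsAtomic φ) : BoundedFormula.IsAtomic (Formula.equivSentence.symm φ) := by
  cases h with
  | equal t s => exact BoundedFormula.IsAtomic.equal _ _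
  | rel r ts => exact BoundedFormula.IsAtomic.rel _ _

/-- A structure embeds in every model of its diagram. -/
theorem exists_embedding_of_model_diagram {M : Type u} [L.Structure M] {K : Type v}
    [L.Structure K] [L[[M]].Structure K] [(L.lhomWithConstants M).IsExpansionOn K]
    (h : K ⊨ diagram L M) : ∃ j : M ↪[L] K, ∀ m, j m = (L.con m : K) := by
  have hatom : ∀ ψ : L.Formula M, BoundedFormula.IsAtomic ψ →
      (ψ.Realize (fun m => (L.con m : K)) ↔ ψ.Realize id) := by
    intro ψ hψ
    have hM : M ⊨ Formula.equivSentence ψ ↔ ψ.Realize id := by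
      rw [Formula.realize_equivSentence]
      rfl
    rw [← Formula.realize_equivSentence, ← hM]
    refine ⟨fun hK => ?_, fun hM => (Theory.model_iff _).1 h _
      ⟨.inl (isAtomic_equivSentence hψ), hM⟩⟩
    by_contra hc
    exact (Sentence.realize_not _).1 ((Theory.model_iff _).1 h (∼(Formula.equivSentence ψ))
      ⟨.inr ⟨_, isAtomic_equivSentence hψ, rfl⟩, (Sentence.realize_not _).2 hc⟩) hK
  refine ⟨⟨⟨fun m => (L.con m : K), fun a b hab => ?_⟩, fun {_} F x => ?_, fun {_} r x => ?_⟩,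
    fun _ => rfl⟩
  · have := hatom (Term.equal (Term.var a) (Term.var b)) (BoundedFormula.IsAtomic.equal _ _)
    rw [Formula.realize_equal, Formula.realize_equal] at this
    exact this.1 hab
  · have := hatom (Term.equal (Term.func F fun i => Term.var (x i))
      (Term.var (Structure.funMap F x))) (BoundedFormula.IsAtomic.equal _ _)
    rw [Formula.realize_equal, Formula.realize_equal] at this
    exact (this.2 rfl).symm
  · have := hatom (r.formula fun i => Term.var (x i)) (BoundedFormula.IsAtomic.rel _ _)
    rw [Formula.realize_rel, Formula.realize_rel] at this
    exact this

theorem model_diagram_of_embedding {M : Type u} [L.Structure M] {K : Type v} [L.Structure K]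
    (j : M ↪[L] K) :
    letI : (constantsOn M).Structure K := constantsOn.structure j
    K ⊨ diagram L M := by
  let _ : (constantsOn M).Structure K := constantsOn.structure j
  have hatom : ∀ φ : L[[M]].Sentence, BoundedFormula.IsAtomic φ → (K ⊨ φ ↔ M ⊨ φ) := by
    intro φ hφ
    have hψ := (isAtomic_equivSentence_symm hφ).isQF.realize_embedding j (v := id) (xs := default)
    have hK : (Formula.equivSentence.symm φ).Realize (j ∘ id) ↔ K ⊨ φ :=
      Formula.realize_equivSentence_symm K φ j
    have hM : (Formula.equivSentence.symm φ).Realize id ↔ M ⊨ φ :=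
      Formula.realize_equivSentence_symm M φ id
    rw [← hK, ← hM, Formula.Realize, Formula.Realize, ← hψ, Unique.eq_default (j ∘ default)]
  refine (Theory.model_iff _).2 fun φ hφ => ?_
  obtain ⟨h | ⟨ψ, h, rfl⟩, hM⟩ := hφ
  · exact (hatom φ h).2 hM
  · rw [Sentence.realize_not] at hM ⊢
    exact fun hK => hM ((hatom ψ h).1 hK)

end ModelTheoryTools

/-! ### The theorem -/

section Main

/-- With `e` and `⁻¹` in the language the axioms are universal, so they pass to substructures. -/
theorem model_abelianCog_of_embedding {M : Type u} {N : Type v} [cog.Structure M] [cog.Structure N]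
    [N ⊨ abelianCog] (f : M ↪[cog] N) : M ⊨ abelianCog := by
  have hmul : ∀ a b, f (Structure.funMap mulF ![a, b]) = f a + f b := fun a b =>
    (f.map_fun mulF ![a, b]).trans (funMap_mul _)
  have hinv : ∀ a, f (Structure.funMap invF ![a]) = -f a := fun a =>
    (f.map_fun invF ![a]).trans (funMap_inv _)
  have hone : f (Structure.funMap oneF ![]) = 0 := (f.map_fun oneF ![]).trans (funMap_one _)
  refine model_abelianCog_iff.2
    { mul_assoc := fun a b c => f.injective (by simp only [hmul, add_assoc])
      one_mul := fun a => f.injective (by simp only [hmul, hone, zero_add])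
      inv_mul := fun a => f.injective (by simp only [hmul, hinv, hone, neg_add_cancel])
      mul_comm := fun a b => f.injective (by simp only [hmul, add_comm])
      strict := fun a b c h => ?_
      cyclic := fun a b c h => (map_rel_iff f).1 ((map_rel_iff f).2 h).rotate
      trans := fun a b c d h h' =>
        (map_rel_iff f).1 (((map_rel_iff f).2 h).trans ((map_rel_iff f).2 h'))
      total := fun a b c h h' h'' => ?_
      compatible := fun a b c d e h => ?_ }
  · obtain ⟨h1, h2, h3⟩ := ((map_rel_iff f).2 h).ne
    exact ⟨fun e => h1 (congrArg f e), fun e => h2 (congrArg f e), fun e => h3 (congrArg f e)⟩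
  · rw [← map_rel_iff f, ← map_rel_iff f]
    exact Rel.total (f.injective.ne h) (f.injective.ne h') (f.injective.ne h'')
  · rw [← map_rel_iff f] at h ⊢
    simp only [hmul, add_assoc, add_comm (f d), rel_add_right_iff]
    exact h

instance nonempty_of_structure {M : Type u} [cog.Structure M] : Nonempty M :=
  ⟨Structure.funMap oneF ![]⟩

theorem exists_isQF_iff_TcD {α : Type} {n : ℕ} (φ : cog.BoundedFormula α n) :
    ∃ θ : cog.BoundedFormula α n, θ.IsQF ∧ (φ ⇔[TcD] θ) := by
  refine exists_isQF_iff_of_ex (fun {m ψ} hψ => exists_isQF_iff TcD _ ?_) φ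
  intro M N _ _ _ _ v xs w ys h hex
  obtain ⟨x, hx⟩ := BoundedFormula.realize_ex.1 hex
  obtain ⟨A, f, v', xs', rfl, rfl, rfl, rfl⟩ := exists_substructure_embedding v xs w ys h
  have hA : A ⊨ abelianCog := model_abelianCog_of_embedding A.subtype
  -- The hull of the generated substructure embeds in both models over the tuple; the witness is
  -- pulled back from `M` to the hull and then sent to `N`.
  obtain ⟨H, _, _, i, hi⟩ := exists_essential_embedding A
  obtain ⟨g, hg, -⟩ := hi.existsUnique_extension A.subtype
  obtain ⟨g', hg', -⟩ := hi.existsUnique_extension f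
  rw [← hg] at hx
  rw [← hg']
  obtain ⟨a, ha⟩ := exists_realize_of_embedding hψ g (i ∘ v') (i ∘ xs') x hx
  have := (hψ.realize_embedding g').2 ha
  rw [Fin.comp_snoc] at this
  exact BoundedFormula.realize_ex.2 ⟨_, this⟩

theorem hasQE_TcD : HasQE TcD := fun _ φ => exists_isQF_iff_TcD φ

/-- An embedding of models of `TcD`, as an elementary embedding. -/
def elementaryEmbedding {M : Type u} {N : Type v} [cog.Structure M] [cog.Structure N] [M ⊨ TcD]
    [N ⊨ TcD] (f : M ↪[cog] N) : M ↪ₑ[cog] N where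
  toFun := f
  map_formula' n φ x := by
    obtain ⟨θ, hθ, h⟩ := hasQE_TcD n φ
    rw [h.realize_iff, h.realize_iff]
    rw [Formula.Realize, Formula.Realize, ← hθ.realize_embedding f, Unique.eq_default (f ∘ default)]

theorem isModelComplete_TcD : IsModelComplete.{u} TcD := fun _ _ _ _ _ _ f _ φ v =>
  (elementaryEmbedding f).map_formula φ v

theorem isPrimeModel_TU : IsPrimeModel.{u} TcD TU := by
  have := model_TcD_TU
  refine ⟨this, fun M _ _ => ?_⟩
  obtain ⟨f⟩ := nonempty_TU_embedding (M := M)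
  exact ⟨elementaryEmbedding f⟩

theorem isComplete_TcD : TcD.IsComplete := by
  have hTU := model_TcD_TU
  refine ⟨Theory.Model.isSatisfiable TU, fun φ => ?_⟩
  have key : ∀ M : Theory.ModelType.{0, 0, 0} TcD, TU ⊨ φ ↔ M ⊨ φ := fun M => by
    obtain ⟨f⟩ := isPrimeModel_TU.2 M M.is_model
    exact f.map_sentence φ
  by_cases h : TU ⊨ φ
  · exact .inl (Theory.models_sentence_iff.2 fun M => (key M).1 h)
  · exact .inr (Theory.models_sentence_iff.2 fun M =>
      (Sentence.realize_not _).2 fun hM => h ((key M).2 hM))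

/-- By model completeness both embeddings are elementary, so elementary amalgamation applies. -/
theorem hasAP_TcD : HasAP.{u} TcD := by
  rintro ⟨M, _⟩ ⟨N, _⟩ ⟨P, _⟩ f g hM hN hP
  have hM : M ⊨ TcD := hM
  have hN : N ⊨ TcD := hN
  have hP : P ⊨ TcD := hP
  obtain ⟨Q, _, hQ, f', g', h⟩ := exists_elementary_amalgam (T := TcD) (elementaryEmbedding f)
    (elementaryEmbedding g)
  refine ⟨⟨Q, inferInstance⟩, f'.toEmbedding, g'.toEmbedding, hQ, ?_⟩
  ext m
  exact h m

/-- Every model of the union receives the hull of `M` over `M`, and does so elementarily; hence the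
truth of each sentence with parameters is decided in the hull. -/
theorem isComplete_union_diagram {M : Type u} [cog.Structure M] [M ⊨ abelianCog] :
    ((cog.lhomWithConstants M).onTheory TcD ∪ diagram cog M).IsComplete := by
  obtain ⟨H, _, hH, i, hi⟩ := exists_essential_embedding M
  have hsat : ((cog.lhomWithConstants M).onTheory TcD ∪ diagram cog M).IsSatisfiable := by
    let _ : (constantsOn M).Structure H := constantsOn.structure i
    have h1 : H ⊨ (cog.lhomWithConstants M).onTheory TcD :=
      (LHom.onTheory_model _ _).2 inferInstance
    have h2 : H ⊨ diagram cog M := model_diagram_of_embedding i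
    have := (Theory.model_union_iff (M := H)).2 ⟨h1, h2⟩
    exact Theory.Model.isSatisfiable H
  have key : ∀ (K : Theory.ModelType.{u, 0, u}
      ((cog.lhomWithConstants M).onTheory TcD ∪ diagram cog M)) (φ : cog[[M]].Sentence),
      K ⊨ φ ↔ (Formula.equivSentence.symm φ).Realize i := by
    intro K φ
    let _ := (cog.lhomWithConstants M).reduct K
    have hK := K.is_model
    rw [Theory.model_union_iff] at hK
    have hT : K ⊨ TcD := (LHom.onTheory_model (cog.lhomWithConstants M) TcD).1 hK.1
    obtain ⟨j, hj⟩ := exists_embedding_of_model_diagram hK.2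
    obtain ⟨h, hh, -⟩ := hi.existsUnique_extension j
    rw [← Formula.realize_equivSentence_symm_con, ← (elementaryEmbedding h).map_formula]
    refine iff_of_eq (congrArg _ (funext fun m => ?_))
    rw [← hj, ← hh]
    rfl
  refine ⟨hsat, fun φ => ?_⟩
  by_cases h : (Formula.equivSentence.symm φ).Realize i
  · exact .inl (Theory.models_sentence_iff.2 fun K => (key K φ).2 h)
  · exact .inr (Theory.models_sentence_iff.2 fun K =>
      (Sentence.realize_not _).2 fun hK => h ((key K φ).1 hK))

theorem isModelCompletion_TcD : IsModelCompletion.{u} TcD abelianCog := by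
  refine ⟨fun M _ _ => abelianCog_of_TcD, fun M _ _ => ?_, fun M _ _ => isComplete_union_diagram⟩
  obtain ⟨H, i₁, i₂, i, -⟩ := exists_essential_embedding M
  exact ⟨H, i₁, i₂, ⟨i⟩⟩

end Main
end CycOrd

theorem theorem1p1 :
    (∀ (M : Type u) [CycOrd.cog.Structure M], M ⊨ CycOrd.TcD ↔ CycOrd.IsCDivisible M) ∧
    (CycOrd.TcD.IsComplete ∧ CycOrd.IsModelComplete.{u} CycOrd.TcD) ∧
    CycOrd.HasAP.{u} CycOrd.TcD ∧
    CycOrd.HasQE CycOrd.TcD ∧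
    CycOrd.IsPrimeModel.{u} CycOrd.TcD CycOrd.TU ∧
    CycOrd.IsModelCompletion.{u} CycOrd.TcD CycOrd.abelianCog ∧
    (∀ (G : Type u) [CycOrd.cog.Structure G], G ⊨ CycOrd.abelianCog →
      ∃ (H : Type u) (_ : CycOrd.cog.Structure H) (i : G ↪[CycOrd.cog] H),
        CycOrd.IsCDivisibleHull i) := by
  refine ⟨CycOrd.model_TcD_iff_isCDivisible, ⟨CycOrd.isComplete_TcD, CycOrd.isModelComplete_TcD⟩,
    CycOrd.hasAP_TcD, CycOrd.hasQE_TcD, CycOrd.isPrimeModel_TU, CycOrd.isModelCompletion_TcD,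
    fun G _ _ => ?_⟩
  obtain ⟨H, i₁, _, i, hi⟩ := CycOrd.exists_essential_embedding G
  exact ⟨H, i₁, i, hi.isCDivisibleHull⟩
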